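/- Let $N>1$, let $p_1,\dots,p_N$ be real numbers, let $\bar p=N\big(\sum_{i=1}^N 1/p_i\big)^{-1}$ be their harmonic mean, and assume $\bar p<N$ and $2<p_i<\bar p^*:=\frac{N\bar p}{N-\bar p}$ for every $i$. Consider the equation $$\partial_t u=\sum_{i=1}^N\partial_i\big(|\partial_i u|^{p_i-2}\,\partial_i u\big).\tag{E}$$ For $\rho,M>0$ put $$\mathcal Q^-_\rho(M)=\prod_{i=1}^N\Big\{|x_i|<M^{\frac{p_i-2}{p_i}}\rho^{\frac{\bar p}{p_i}}\Big\}\times(-\rho^{\bar p},0],\qquad K_1=(-1,1)^N,\qquad Q_1=K_1\times(-1,1],\qquad Q_1^-=K_1\times(-1,0].$$ A local weak super-solution (resp. sub-solution) of (E) in $Q_1$ is a function $$u\in C^0_{loc}(-1,1;L^2_{loc}(K_1))\cap L^1_{loc}(-1,1;W^{1,1}_{loc}(K_1))$$ with weak derivatives $\partial_i u\in L^{p_i}_{loc}(-1,1;L^{p_i}_{loc}(K_1))$, $i=1,\dots,N$, such that for every compact $K\subset K_1$, all $-1<t_1<t_2<1$ and every nonnegative function $\varphi\in C^\infty(\mathbb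 R^N\times(-1,1))$ with $\varphi(\cdot,t)$ supported in $K$ for all $t\in(-1,1)$, $$\int_K u\varphi\,dx\Big|_{t_1}^{t_2}+\int_{t_1}^{t_2}\!\!\int_K\Big(-u\,\partial_t\varphi+\sum_{i=1}^N|\partial_iu|^{p_i-2}\,\partial_iu\,\partial_i\varphi\Big)dx\,dt\ \ge 0\quad(\text{resp. }\le 0).$$ Let $a\in(0,1)$. Then: 1. There is $\nu_a^+>0$, depending only on $a$, $N$ and $p_1,\dots,p_N$, such that for every local weak super-solution $u$ of (E) in $Q_1$ with $\operatorname{ess\,inf}_{Q_1^-}u\ge0$, $$\big|[u\le1]\cap\mathcal Q_1^-(1)\big|\le\nu_a^+\,\big|\mathcal Q_1^-(1)\big|\ \Longrightarrow\ \operatorname*{ess\,inf}_{\mathcal Q^-_{1/2}(1)}u\ge a.$$ 2. There is $\nu_a^->0$, depending only on $a$, $N$ and $p_1,\dots,p_N$, such that for every local weak sub-solution $u$ of (E) in $Q_1$ with $\operatorname{ess\,sup}_{Q_1^-}u\le1$, $$\big|[u\ge1/2]\cap\mathcal Q_1^-(1/2)\big|\le\nu_a^-\,\big|\mathcal Q_1^-(1/2)\big|\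 \Longrightarrow\ \operatorname*{ess\,sup}_{\mathcal Q^-_{1/2}(1/2)}u\le1-\frac a2.$$ -/

import Mathlib

open MeasureTheory Set Filter Topology
open scoped ContDiff ENNReal

noncomputable section

namespace AnisotropicParabolic

/-- The harmonic mean `N (∑ 1/pᵢ)⁻¹` of the exponents. -/
def harmonicMean {N : ℕ} (p : Fin N → ℝ) : ℝ :=
  (N : ℝ) * (∑ i, 1 / p i)⁻¹

/-- The Sobolev exponent of the harmonic mean (meaningful when `harmonicMean p < N`). -/
def sobolevExponent {N : ℕ} (p : Fin N → ℝ) : ℝ :=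
  (N : ℝ) * harmonicMean p / ((N : ℝ) - harmonicMean p)

/-- The open cube of side `2ρ` centred at the origin. -/
def cube (N : ℕ) (ρ : ℝ) : Set (Fin N → ℝ) :=
  {x | ∀ i, |x i| < ρ}

/-- The backward cylinder `K_ρ × (-τ, 0]`. -/
def backwardCylinder (N : ℕ) (ρ τ : ℝ) : Set ((Fin N → ℝ) × ℝ) :=
  cube N ρ ×ˢ Ioc (-τ) 0

/-- The intrinsic anisotropic cube of radius `ρ` and parameter `M`. -/
def intrinsicCube {N : ℕ} (p : Fin N → ℝ) (ρ M : ℝ) : Set (Fin N → ℝ) :=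
  {x | ∀ i, |x i| < M ^ ((p i - 2) / p i) * ρ ^ (harmonicMean p / p i)}

/-- The backward intrinsic cylinder of radius `ρ` and parameter `M`. -/
def backwardIntrinsicCylinder {N : ℕ} (p : Fin N → ℝ) (ρ M : ℝ) :
    Set ((Fin N → ℝ) × ℝ) :=
  intrinsicCube p ρ M ×ˢ Ioc (-(ρ ^ harmonicMean p)) 0

/-- `g` is the `i`-th weak partial derivative of `f` in `Ω`; both are in `L¹_loc(Ω)`. -/
structure HasWeakPartial {N : ℕ} (Ω : Set (Fin N → ℝ)) (i : Fin N)
    (f g : (Fin N → ℝ) → ℝ) : Prop where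
  locallyIntegrable : ∀ K : Set (Fin N → ℝ), IsCompact K → K ⊆ Ω → IntegrableOn f K volume
  locallyIntegrable_deriv :
    ∀ K : Set (Fin N → ℝ), IsCompact K → K ⊆ Ω → IntegrableOn g K volume
  integral_eq : ∀ ψ : (Fin N → ℝ) → ℝ, ContDiff ℝ ∞ ψ → HasCompactSupport ψ →
    tsupport ψ ⊆ Ω →
      ∫ x in Ω, f x * fderiv ℝ ψ x (Pi.single i 1) = -∫ x in Ω, g x * ψ x

/-- `u` belongs to `C⁰_loc(-T,T; L²_loc(Ω))`; `u` itself is the representative that is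
continuous in time. -/
structure TimeContinuousL2Loc {N : ℕ} (Ω : Set (Fin N → ℝ)) (T : ℝ)
    (u : (Fin N → ℝ) × ℝ → ℝ) : Prop where
  memLp : ∀ K : Set (Fin N → ℝ), IsCompact K → K ⊆ Ω → ∀ t ∈ Ioo (-T) T,
    MemLp (fun x => u (x, t)) 2 (volume.restrict K)
  tendsto : ∀ K : Set (Fin N → ℝ), IsCompact K → K ⊆ Ω → ∀ t ∈ Ioo (-T) T,
    Tendsto (fun s => eLpNorm (fun x => u (x, s) - u (x, t)) 2 (volume.restrict K))
      (𝓝 t) (𝓝 0)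

/-- `u` belongs to the local anisotropic space: `u` is in `L¹_loc(-T,T; W^{1,1}_loc(Ω))`, with
spatial weak derivatives `∂ᵢu = g i` in `L^{pᵢ}_loc(-T,T; L^{pᵢ}_loc(Ω))`. -/
structure HasAnisotropicGradient {N : ℕ} (p : Fin N → ℝ) (Ω : Set (Fin N → ℝ)) (T : ℝ)
    (u : (Fin N → ℝ) × ℝ → ℝ) (g : Fin N → (Fin N → ℝ) × ℝ → ℝ) : Prop where
  integrableOn : ∀ K : Set (Fin N → ℝ), IsCompact K → K ⊆ Ω →
    ∀ t₁ ∈ Ioo (-T) T, ∀ t₂ ∈ Ioo (-T) T, IntegrableOn u (K ×ˢ Icc t₁ t₂) volume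
  hasWeakPartial : ∀ i, ∀ᵐ t ∂(volume.restrict (Ioo (-T) T)),
    HasWeakPartial Ω i (fun x => u (x, t)) (fun x => g i (x, t))
  memLp : ∀ i, ∀ K : Set (Fin N → ℝ), IsCompact K → K ⊆ Ω →
    ∀ t₁ ∈ Ioo (-T) T, ∀ t₂ ∈ Ioo (-T) T,
      MemLp (g i) (ENNReal.ofReal (p i)) (volume.restrict (K ×ˢ Icc t₁ t₂))

/-- Nonnegative test functions: smooth for `-T < t < T`, with `φ(·,t)` supported in the
compact set `K` for every such `t`. -/
structure IsNonnegTestFunction {N : ℕ} (K : Set (Fin N → ℝ)) (T : ℝ)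
    (φ : (Fin N → ℝ) × ℝ → ℝ) : Prop where
  contDiffOn : ContDiffOn ℝ ∞ φ (univ ×ˢ Ioo (-T) T)
  eq_zero : ∀ x, x ∉ K → ∀ t ∈ Ioo (-T) T, φ (x, t) = 0
  nonneg : ∀ x, ∀ t ∈ Ioo (-T) T, 0 ≤ φ (x, t)

/-- The left-hand side of the weak formulation:
`∫_K u φ dx |_{t₁}^{t₂} + ∫_{t₁}^{t₂} ∫_K (-u ∂ₜφ + ∑ᵢ |∂ᵢu|^{pᵢ-2} ∂ᵢu ∂ᵢφ) dx dt`,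
where `g i` stands for `∂ᵢu`. -/
def weakForm {N : ℕ} (p : Fin N → ℝ) (K : Set (Fin N → ℝ)) (t₁ t₂ : ℝ)
    (u : (Fin N → ℝ) × ℝ → ℝ) (g : Fin N → (Fin N → ℝ) × ℝ → ℝ)
    (φ : (Fin N → ℝ) × ℝ → ℝ) : ℝ :=
  ((∫ x in K, u (x, t₂) * φ (x, t₂)) - ∫ x in K, u (x, t₁) * φ (x, t₁)) +
    ∫ z in K ×ˢ Icc t₁ t₂,
      (-(u z * fderiv ℝ φ z (0, 1)) +
        ∑ i, |g i z| ^ (p i - 2) * g i z * fderiv ℝ φ z (Pi.single i 1, 0))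

/-- `u` is a local weak super-solution of `∂ₜu = ∑ᵢ ∂ᵢ(|∂ᵢu|^{pᵢ-2} ∂ᵢu)` in `Ω × (-T,T)`. -/
def IsLocalWeakSuperSolution {N : ℕ} (p : Fin N → ℝ) (Ω : Set (Fin N → ℝ)) (T : ℝ)
    (u : (Fin N → ℝ) × ℝ → ℝ) : Prop :=
  TimeContinuousL2Loc Ω T u ∧
    ∃ g : Fin N → (Fin N → ℝ) × ℝ → ℝ, HasAnisotropicGradient p Ω T u g ∧
      ∀ K : Set (Fin N → ℝ), IsCompact K → K ⊆ Ω →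
        ∀ t₁ ∈ Ioo (-T) T, ∀ t₂ ∈ Ioo (-T) T, t₁ < t₂ →
          ∀ φ, IsNonnegTestFunction K T φ → 0 ≤ weakForm p K t₁ t₂ u g φ

/-- `u` is a local weak sub-solution of `∂ₜu = ∑ᵢ ∂ᵢ(|∂ᵢu|^{pᵢ-2} ∂ᵢu)` in `Ω × (-T,T)`. -/
def IsLocalWeakSubSolution {N : ℕ} (p : Fin N → ℝ) (Ω : Set (Fin N → ℝ)) (T : ℝ)
    (u : (Fin N → ℝ) × ℝ → ℝ) : Prop :=
  TimeContinuousL2Loc Ω T u ∧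
    ∃ g : Fin N → (Fin N → ℝ) × ℝ → ℝ, HasAnisotropicGradient p Ω T u g ∧
      ∀ K : Set (Fin N → ℝ), IsCompact K → K ⊆ Ω →
        ∀ t₁ ∈ Ioo (-T) T, ∀ t₂ ∈ Ioo (-T) T, t₁ < t₂ →
          ∀ φ, IsNonnegTestFunction K T φ → weakForm p K t₁ t₂ u g φ ≤ 0

/-- The essential infimum over `A`, as an extended real number. -/
def essInfOn {N : ℕ} (A : Set ((Fin N → ℝ) × ℝ)) (u : (Fin N → ℝ) × ℝ → ℝ) : EReal :=
  essInf (fun z => (u z : EReal)) (volume.restrict A)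

/-- The essential supremum over `A`, as an extended real number. -/
def essSupOn {N : ℕ} (A : Set ((Fin N → ℝ) × ℝ)) (u : (Fin N → ℝ) × ℝ → ℝ) : EReal :=
  essSup (fun z => (u z : EReal)) (volume.restrict A)

end AnisotropicParabolic

end

open AnisotropicParabolic

namespace AnisotropicParabolic

/-! The result is a De Giorgi critical mass lemma for a nonnegative super-solution `v`; the
sub-solution statement is the same lemma for `v = 1 - u`. The parameter is fixed at `1` or `1/2`, so
the cylinders have fixed size and constants may depend on them.

In place of cut-offs on shrinking cylinders there is one smooth barrier `ψ ≤ M`, equal to `M` on the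
small cylinder and supported in the large one. Since `v ≥ 0`, the function `W = (ψ - ℓ - v)₊` with
`ℓ ≥ 0` lives on the support of `ψ` and localizes by itself. Testing the equation with `W²` bounds
both `sup_t ∫ W³` and `∑ᵢ ∬ W |∂ᵢv|^{pᵢ}` by a constant times the measure of `{v < ψ - ℓ}` in that
support (`SmoothData.energy_estimate`). As `∂ᵢ(W²) = 2W(∂ᵢψ - ∂ᵢv)` and `|s| ≤ 1 + |s|^{pᵢ}`, the
gradient of `W²` is then controlled in `L¹`. The Sobolev inequality of `W^{1,1}` on time slices,
combined with the bound on `∫ W³`, gives `∬ W^{2+3/N} ≤ C |{v ≤ ψ - ℓ}|^{1+1/N}`. No anisotropic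
embedding is involved, because different exponents only change constants.

With levels `ℓ` increasing to `M - m`, Chebyshev's inequality turns this into a superlinear
recursion for the measures, and `fast_geometric_convergence` sends them to zero when the first one
is small (`exists_threshold_upTo`). On the small cylinder, where `ψ = M`, this says `v > m` almost
everywhere.

A weak super-solution has no time derivative, so the estimate is proved for space-time
mollifications and passed to the limit (`IsDistributionalSuperSolution.lintegral_truncation_le`).
The mollified flux is not the flux of the mollified gradient; `tendsto_lintegral_flux_commutator`
shows that the error vanishes. Positivity is known only for `t ≤ 0`, so the argument runs up to a
time `T < 0`, with a threshold independent of `T`, and then `T` tends to `0`. -/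

/-! ### Elementary inequalities and fast geometric convergence. -/

theorem hasDerivAt_max_zero_pow (n : ℕ) (x : ℝ) :
    HasDerivAt (fun y : ℝ => max y 0 ^ (n + 2)) ((n + 2 : ℕ) * max x 0 ^ (n + 1)) x := by
  rcases lt_trichotomy x 0 with hx | rfl | hx
  · have h : (fun y : ℝ => max y 0 ^ (n + 2)) =ᶠ[𝓝 x] fun _ => 0 := by
      filter_upwards [gt_mem_nhds hx] with y hy
      simp [max_eq_right hy.le]
    simpa [max_eq_right hx.le] using (hasDerivAt_const x (0 : ℝ)).congr_of_eventuallyEq h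
  · have h : (fun y : ℝ => max y 0 ^ (n + 2)) =O[𝓝 0] fun y => ‖y - 0‖ ^ (n + 2) := by
      refine Asymptotics.IsBigO.of_bound 1 (Eventually.of_forall fun y => ?_)
      rw [one_mul, sub_zero, norm_pow, norm_pow, norm_norm]
      gcongr
      rw [Real.norm_eq_abs, Real.norm_eq_abs, abs_of_nonneg (le_max_right _ _)]
      exact max_le (le_abs_self y) (abs_nonneg y)
    have := (h.hasFDerivAt (by omega)).hasDerivAt
    simpa using this
  · have h : (fun y : ℝ => max y 0 ^ (n + 2)) =ᶠ[𝓝 x] fun y => y ^ (n + 2) := by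
      filter_upwards [lt_mem_nhds hx] with y hy
      simp [max_eq_left hy.le]
    have := (hasDerivAt_pow (n + 2) x).congr_of_eventuallyEq h
    simpa [max_eq_left hx.le] using this

/-- A power at least two removes the corner of the positive part. Hence the squares and cubes of
truncations of `C¹` functions can be differentiated classically. -/
theorem contDiff_max_zero_pow (n : ℕ) : ContDiff ℝ 1 (fun y : ℝ => max y 0 ^ (n + 2)) := by
  rw [contDiff_one_iff_deriv]
  refine ⟨fun x => (hasDerivAt_max_zero_pow n x).differentiableAt, ?_⟩
  have : deriv (fun y : ℝ => max y 0 ^ (n + 2)) = fun x => ((n + 2 : ℕ) : ℝ) * max x 0 ^ (n + 1) :=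
    funext fun x => (hasDerivAt_max_zero_pow n x).deriv
  rw [this]
  fun_prop

theorem rpow_sub_one_mul_le {X Y p : ℝ} (hX : 0 ≤ X) (hY : 0 ≤ Y) (hp : 1 < p) :
    X ^ (p - 1) * Y ≤ X ^ p + Y ^ p := by
  have key : ∀ Z : ℝ, 0 ≤ Z → Z ^ (p - 1) * Z = Z ^ p := fun Z hZ => by
    rw [← Real.rpow_add_one' hZ (by linarith)]; ring_nf
  rcases le_total X Y with h | h
  · calc X ^ (p - 1) * Y ≤ Y ^ (p - 1) * Y := by
          gcongr
      _ = Y ^ p := key Y hY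
      _ ≤ _ := le_add_of_nonneg_left (by positivity)
  · calc X ^ (p - 1) * Y ≤ X ^ (p - 1) * X := by gcongr
      _ = X ^ p := key X hX
      _ ≤ _ := le_add_of_nonneg_right (by positivity)

theorem le_one_add_rpow {X p : ℝ} (hX : 0 ≤ X) {q : ℝ} (hq : 0 ≤ q) (hqp : q ≤ p) :
    X ^ q ≤ 1 + X ^ p := by
  rcases le_total X 1 with h | h
  · have := Real.rpow_le_one hX h hq
    have := Real.rpow_nonneg hX p
    linarith
  · have := Real.rpow_le_rpow_of_exponent_le h hqp
    linarith

/-- Fast geometric convergence. -/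
theorem fast_geometric_convergence {N : ℕ} (hN : 0 < N) {C b : ℝ} (hC : 0 < C) (hb : 1 < b)
    {Y : ℕ → ℝ} (hY : ∀ n, 0 ≤ Y n)
    (hrec : ∀ n, Y (n + 1) ≤ C * b ^ n * Y n ^ (1 + 1 / (N : ℝ)))
    (h0 : Y 0 ≤ (C * b ^ N)⁻¹ ^ N) : Tendsto Y atTop (𝓝 0) := by
  have hb0 : 0 < b := by linarith
  set ν : ℝ := (C * b ^ N)⁻¹ ^ N with hν
  have hN' : (N : ℝ) ≠ 0 := by exact_mod_cast hN.ne'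
  -- The ratio `b⁻ᴺ` is chosen so that its `N`-th root cancels the growth `bⁿ`; the value of `ν`
  -- then makes the induction close exactly.
  have key : ∀ n, Y n ≤ ν * (b⁻¹ ^ N) ^ n := by
    intro n
    induction n with
    | zero => simpa using h0
    | succ n ih =>
      have h1 : (ν * (b⁻¹ ^ N) ^ n) ^ (1 / (N : ℝ)) = (C * b ^ N)⁻¹ * b⁻¹ ^ n := by
        have : ν * (b⁻¹ ^ N) ^ n = ((C * b ^ N)⁻¹ * b⁻¹ ^ n) ^ N := by
          rw [hν]; ring
        rw [this, one_div, Real.pow_rpow_inv_natCast (by positivity) hN.ne']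
      calc Y (n + 1) ≤ C * b ^ n * Y n ^ (1 + 1 / (N : ℝ)) := hrec n
        _ ≤ C * b ^ n * (ν * (b⁻¹ ^ N) ^ n) ^ (1 + 1 / (N : ℝ)) := by
          gcongr
          exact hY n
        _ = C * b ^ n * ((ν * (b⁻¹ ^ N) ^ n) * ((C * b ^ N)⁻¹ * b⁻¹ ^ n)) := by
          rw [Real.rpow_add (by positivity), Real.rpow_one, h1]
        _ = ν * (b⁻¹ ^ N) ^ (n + 1) := by
          rw [mul_inv, inv_pow, inv_pow, inv_pow, inv_pow, pow_succ]
          field_simp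
  have hlim : Tendsto (fun n => ν * (b⁻¹ ^ N) ^ n) atTop (𝓝 0) := by
    have := tendsto_pow_atTop_nhds_zero_of_lt_one (r := b⁻¹ ^ N) (by positivity)
      (pow_lt_one₀ (by positivity) (inv_lt_one_of_one_lt₀ hb) hN.ne')
    simpa using this.const_mul ν
  exact squeeze_zero hY key hlim

/-! ### The `W^{1,1}` Sobolev inequality, and integration by parts up to a given time. -/

/-- Hölder's inequality with exponents `N/(N-1)` and `N`, followed by the Gagliardo–Nirenberg
inequality `‖f‖_{N/(N-1)} ≤ ‖∇f‖₁`. The weight `h` will be the cube of the truncation. -/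
theorem lintegral_mul_rpow_le_sobolev {N : ℕ} (hN : 1 < N) {f : (Fin N → ℝ) → ℝ}
    (hf : ContDiff ℝ 1 f) (hfs : HasCompactSupport f) {h : (Fin N → ℝ) → ℝ≥0∞}
    (hh : Measurable h) :
    ∫⁻ x, ‖f x‖ₑ * h x ^ (1 / (N : ℝ)) ≤
      (∫⁻ x, ‖fderiv ℝ f x‖ₑ) * (∫⁻ x, h x) ^ (1 / (N : ℝ)) := by
  have hN' : (1 : ℝ) < N := by exact_mod_cast hN
  have hc := Real.HolderConjugate.conjExponent hN'
  set q : ℝ := Real.conjExponent N with hq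
  have h1 := ENNReal.lintegral_mul_le_Lp_mul_Lq volume hc.symm (f := fun x => ‖f x‖ₑ)
    (g := fun x => h x ^ (1 / (N : ℝ))) hf.continuous.enorm.aemeasurable
    (hh.pow_const _).aemeasurable
  have h2 := lintegral_pow_le_pow_lintegral_fderiv_aux (ι := Fin N) (F := ℝ) (p := q)
    (by simpa using hc) hf hfs
  refine h1.trans ?_
  have hN0 : (N : ℝ) ≠ 0 := by positivity
  have h3 : ∀ x, (h x ^ (1 / (N : ℝ))) ^ (N : ℝ) = h x := fun x => by
    rw [← ENNReal.rpow_mul, one_div_mul_cancel hN0, ENNReal.rpow_one]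
  simp only [h3]
  gcongr
  have hq0 : 0 < q := hc.symm.pos
  calc (∫⁻ x, ‖f x‖ₑ ^ q) ^ (1 / q) ≤ ((∫⁻ x, ‖fderiv ℝ f x‖ₑ) ^ q) ^ (1 / q) := by gcongr
    _ = _ := by rw [← ENNReal.rpow_mul, mul_one_div_cancel hq0.ne', ENNReal.rpow_one]

section Slices

variable {N : ℕ} {g : (Fin N → ℝ) × ℝ → ℝ}

theorem hasCompactSupport_space_slice (hg : HasCompactSupport g) (s : ℝ) :
    HasCompactSupport fun x => g (x, s) := by
  refine HasCompactSupport.intro (hg.isCompact.image continuous_fst) fun x hx => ?_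
  by_contra h
  exact hx ⟨(x, s), subset_tsupport _ h, rfl⟩

theorem hasCompactSupport_time_slice (hg : HasCompactSupport g) (x : Fin N → ℝ) :
    HasCompactSupport fun s => g (x, s) := by
  refine HasCompactSupport.intro (hg.isCompact.image continuous_snd) fun s hs => ?_
  by_contra h
  exact hs ⟨(x, s), subset_tsupport _ h, rfl⟩

theorem hasFDerivAt_space_slice {x : Fin N → ℝ} {s : ℝ} (hg : DifferentiableAt ℝ g (x, s)) :
    HasFDerivAt (fun y => g (y, s))
      ((fderiv ℝ g (x, s)).comp (ContinuousLinearMap.inl ℝ (Fin N → ℝ) ℝ)) x :=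
  hg.hasFDerivAt.comp x (hasFDerivAt_prodMk_left x s)

theorem fderiv_space_slice {x : Fin N → ℝ} {s : ℝ} (hg : DifferentiableAt ℝ g (x, s))
    (e : Fin N → ℝ) : fderiv ℝ (fun y => g (y, s)) x e = fderiv ℝ g (x, s) (e, 0) := by
  rw [(hasFDerivAt_space_slice hg).fderiv]
  simp

theorem hasDerivAt_time_slice {x : Fin N → ℝ} {s : ℝ} (hg : DifferentiableAt ℝ g (x, s)) :
    HasDerivAt (fun r => g (x, r)) (fderiv ℝ g (x, s) (0, 1)) s := by
  have := (hg.hasFDerivAt.comp s (hasFDerivAt_prodMk_right x s)).hasDerivAt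
  simpa [Function.comp_def] using this

/-- Lebesgue measure on `ℝᴺ × (-∞, t]`. -/
noncomputable def volumeUpTo (N : ℕ) (t : ℝ) : Measure ((Fin N → ℝ) × ℝ) :=
  (volume : Measure (Fin N → ℝ)).prod (volume.restrict (Iic t))

theorem volumeUpTo_eq (N : ℕ) (t : ℝ) :
    volumeUpTo N t = volume.restrict {z : (Fin N → ℝ) × ℝ | z.2 ≤ t} := by
  have : {z : (Fin N → ℝ) × ℝ | z.2 ≤ t} = univ ×ˢ Iic t := by ext; simp
  rw [this, Measure.volume_eq_prod, ← Measure.prod_restrict, Measure.restrict_univ, volumeUpTo]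

instance (N : ℕ) (t : ℝ) : IsFiniteMeasureOnCompacts (volumeUpTo N t) := by
  rw [volumeUpTo_eq]; infer_instance

instance (N : ℕ) (t : ℝ) : SFinite (volumeUpTo N t) := by
  rw [volumeUpTo_eq]; infer_instance

theorem integral_space_eq_integral_time_deriv (hg : ContDiff ℝ 1 g) (hgs : HasCompactSupport g)
    (t : ℝ) :
    ∫ x, g (x, t) = ∫ z, fderiv ℝ g z (0, 1) ∂volumeUpTo N t := by
  have hint : Integrable (fun z => fderiv ℝ g z (0, 1)) (volumeUpTo N t) := by
    apply Continuous.integrable_of_hasCompactSupport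
    · exact (hg.continuous_fderiv one_ne_zero).clm_apply continuous_const
    · exact hgs.fderiv_apply ℝ _
  rw [volumeUpTo] at *
  rw [integral_prod _ hint]
  congr 1
  ext x
  have hd := hg.differentiable one_ne_zero
  have h1 : ContDiff ℝ 1 fun s => g (x, s) := hg.comp (by fun_prop)
  have := HasCompactSupport.integral_Iic_deriv_eq h1 (hasCompactSupport_time_slice hgs x) t
  rw [← this]
  congr 1
  ext s
  exact (hasDerivAt_time_slice (hd _)).deriv

/-- The domain is cut in time only, so spatial integration by parts on each slice leaves no boundary
term. -/
theorem integral_mul_space_fderiv_eq_neg {f : (Fin N → ℝ) × ℝ → ℝ} (hg : ContDiff ℝ 1 g)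
    (hgs : HasCompactSupport g) (hf : ContDiff ℝ 1 f) (t : ℝ) (e : Fin N → ℝ) :
    ∫ z, g z * fderiv ℝ f z (e, 0) ∂volumeUpTo N t =
      -∫ z, fderiv ℝ g z (e, 0) * f z ∂volumeUpTo N t := by
  have cg := hg.continuous
  have cf := hf.continuous
  have cg' : Continuous fun z => fderiv ℝ g z (e, 0) :=
    (hg.continuous_fderiv one_ne_zero).clm_apply continuous_const
  have cf' : Continuous fun z => fderiv ℝ f z (e, 0) :=
    (hf.continuous_fderiv one_ne_zero).clm_apply continuous_const
  have hgs' : HasCompactSupport fun z => fderiv ℝ g z (e, 0) := hgs.fderiv_apply ℝ _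
  have hint1 : Integrable (fun z => g z * fderiv ℝ f z (e, 0)) (volumeUpTo N t) :=
    (cg.mul cf').integrable_of_hasCompactSupport hgs.mul_right
  have hint2 : Integrable (fun z => fderiv ℝ g z (e, 0) * f z) (volumeUpTo N t) :=
    (cg'.mul cf).integrable_of_hasCompactSupport hgs'.mul_right
  rw [volumeUpTo] at *
  rw [integral_prod_symm _ hint1, integral_prod_symm _ hint2, ← integral_neg]
  congr 1
  ext s
  have hdg := hg.differentiable one_ne_zero
  have hdf := hf.differentiable one_ne_zero
  have hs := hasCompactSupport_space_slice hgs s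
  have hs' := hasCompactSupport_space_slice hgs' s
  have := integral_mul_fderiv_eq_neg_fderiv_mul_of_integrable (𝕜 := ℝ) (μ := volume)
    (f := fun x => g (x, s)) (g := fun x => f (x, s)) (v := e) ?_ ?_ ?_ ?_ ?_
  · simpa only [fderiv_space_slice (hdg _), fderiv_space_slice (hdf _)] using this
  · simp only [fderiv_space_slice (hdg _)]
    exact Continuous.integrable_of_hasCompactSupport (by fun_prop) hs'.mul_right
  · simp only [fderiv_space_slice (hdf _)]
    exact Continuous.integrable_of_hasCompactSupport (by fun_prop) hs.mul_right
  · exact Continuous.integrable_of_hasCompactSupport (by fun_prop) hs.mul_right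
  · exact fun x _ => (hasFDerivAt_space_slice (hdg _)).differentiableAt
  · exact fun x _ => (hasFDerivAt_space_slice (hdf _)).differentiableAt

end Slices

/-! ### The flux and the energy estimate for smooth data. -/

/-- The scalar flux `s ↦ |s|^(p-2) s`. -/
noncomputable def flux (p s : ℝ) : ℝ := |s| ^ (p - 2) * s

theorem abs_flux {p : ℝ} (hp : 1 < p) (s : ℝ) : |flux p s| = |s| ^ (p - 1) := by
  rw [flux, abs_mul, abs_of_nonneg (by positivity : 0 ≤ |s| ^ (p - 2)),
    ← Real.rpow_add_one' (abs_nonneg s) (by linarith)]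
  ring_nf

theorem flux_mul_self {p : ℝ} (hp : 1 < p) (s : ℝ) : flux p s * s = |s| ^ p := by
  rw [flux, mul_assoc, ← abs_mul_abs_self s, ← mul_assoc,
    ← Real.rpow_add_one' (abs_nonneg s) (by linarith),
    ← Real.rpow_add_one' (abs_nonneg s) (by linarith)]
  ring_nf

/-- Pointwise absorption: `b` is the flux with error, `d` the derivative of the barrier and `s`
that of the solution. -/
theorem flux_absorption {p L b d s : ℝ} (hp : 1 < p) (hL : 0 ≤ L) (hd : |d| ≤ L) :
    2 * (b * (d - s)) + |s| ^ p ≤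
      (2 * L) ^ p + 2 * (L + 1) * (|b - flux p s| * (1 + |s|)) := by
  set F := b - flux p s with hF
  have hb : b = flux p s + F := by rw [hF]; ring
  have h1 : flux p s * d ≤ |s| ^ (p - 1) * L := by
    calc flux p s * d ≤ |flux p s * d| := le_abs_self _
      _ = |s| ^ (p - 1) * |d| := by rw [abs_mul, abs_flux hp]
      _ ≤ _ := by gcongr
  -- Taking `Y = 2L` costs exactly one `|s|^p`. Of the `-2|s|^p` coming from `2 * flux p s * (d -
  -- s)`, one copy pays for this and the other for the term on the left-hand side.
  have h2 := rpow_sub_one_mul_le (abs_nonneg s) (by positivity : 0 ≤ 2 * L) hp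
  have h3 := flux_mul_self hp s
  have h4 : F * (d - s) ≤ (L + 1) * (|F| * (1 + |s|)) := by
    calc F * (d - s) ≤ |F * (d - s)| := le_abs_self _
      _ = |F| * |d - s| := abs_mul _ _
      _ ≤ |F| * (L + |s|) := by
        gcongr
        exact (abs_sub _ _).trans (by gcongr)
      _ ≤ |F| * ((L + 1) * (1 + |s|)) := by
        gcongr
        nlinarith [abs_nonneg s]
      _ = _ := by ring
  rw [hb]
  nlinarith

section Smooth

variable {N : ℕ}

/-- The truncation `(ψ - ℓ - v)₊`. -/
noncomputable def truncation (ψ v : (Fin N → ℝ) × ℝ → ℝ) (ℓ : ℝ) (z : (Fin N → ℝ) × ℝ) : ℝ :=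
  max (ψ z - ℓ - v z) 0

/-- Smooth data for one step of the iteration: `v ≥ 0` satisfies `∂ₜv ≥ ∑ ∂ᵢaᵢ` on the support of
the barrier `ψ` up to time `T`. -/
structure SmoothData (L M T : ℝ) (ψ v : (Fin N → ℝ) × ℝ → ℝ) (b : Fin N → (Fin N → ℝ) × ℝ → ℝ) :
    Prop where
  contDiff_barrier : ContDiff ℝ 1 ψ
  hasCompactSupport : HasCompactSupport ψ
  barrier_le : ∀ z, ψ z ≤ M
  fderiv_barrier_le : ∀ z, ‖fderiv ℝ ψ z‖ ≤ L
  contDiff : ContDiff ℝ 1 v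
  nonneg : ∀ z, 0 ≤ v z
  contDiff_flux : ∀ i, ContDiff ℝ 1 (b i)
  supersolution : ∀ z ∈ tsupport ψ, z.2 ≤ T →
    ∑ i, fderiv ℝ (b i) z (Pi.single i 1, 0) ≤ fderiv ℝ v z (0, 1)

variable {L M T ℓ : ℝ} {ψ v : (Fin N → ℝ) × ℝ → ℝ} {b : Fin N → (Fin N → ℝ) × ℝ → ℝ}

theorem truncation_nonneg (z : (Fin N → ℝ) × ℝ) : 0 ≤ truncation ψ v ℓ z := le_max_right _ _

namespace SmoothData

variable (h : SmoothData L M T ψ v b)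
include h

theorem fderiv_apply_le (z : (Fin N → ℝ) × ℝ) (i : Fin N) :
    |fderiv ℝ ψ z (Pi.single i 1, 0)| ≤ L := by
  have := (fderiv ℝ ψ z).le_opNorm (Pi.single i (1 : ℝ), (0 : ℝ))
  have h2 : ‖((Pi.single i 1 : Fin N → ℝ), (0 : ℝ))‖ = 1 := by
    simp [Prod.norm_def, Pi.norm_single]
  rw [h2, mul_one] at this
  exact this.trans (h.fderiv_barrier_le z)

theorem fderiv_time_le (z : (Fin N → ℝ) × ℝ) : |fderiv ℝ ψ z (0, 1)| ≤ L := by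
  have := (fderiv ℝ ψ z).le_opNorm ((0 : Fin N → ℝ), (1 : ℝ))
  have h2 : ‖((0 : Fin N → ℝ), (1 : ℝ))‖ = 1 := by simp [Prod.norm_def]
  rw [h2, mul_one] at this
  exact this.trans (h.fderiv_barrier_le z)

theorem bound_nonneg : 0 ≤ L := (norm_nonneg _).trans (h.fderiv_barrier_le 0)

/-- This is where positivity of `v` enters: it makes the truncation compactly supported, so its
powers are admissible test functions without a cut-off. -/
theorem truncation_eq_zero (hℓ : 0 ≤ ℓ) {z : (Fin N → ℝ) × ℝ} (hz : z ∉ tsupport ψ) :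
    truncation ψ v ℓ z = 0 := by
  rw [truncation, image_eq_zero_of_notMem_tsupport hz]
  exact max_eq_right (by linarith [h.nonneg z])

theorem truncation_le (hM : 0 ≤ M) (hℓ : 0 ≤ ℓ) (z : (Fin N → ℝ) × ℝ) :
    truncation ψ v ℓ z ≤ M :=
  max_le (by linarith [h.nonneg z, h.barrier_le z]) hM

theorem continuous_truncation : Continuous (truncation ψ v ℓ) := by
  have := h.contDiff_barrier.continuous
  have := h.contDiff.continuous
  unfold truncation
  fun_prop

theorem hasCompactSupport_truncation_pow (hℓ : 0 ≤ ℓ) (n : ℕ) :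
    HasCompactSupport fun z => truncation ψ v ℓ z ^ (n + 1) :=
  HasCompactSupport.intro h.hasCompactSupport.isCompact fun z hz => by
    simp [h.truncation_eq_zero hℓ hz]

theorem contDiff_truncation_pow (n : ℕ) :
    ContDiff ℝ 1 fun z => truncation ψ v ℓ z ^ (n + 2) :=
  (contDiff_max_zero_pow n).comp ((h.contDiff_barrier.sub contDiff_const).sub h.contDiff)

theorem fderiv_truncation_pow (n : ℕ) (z e : (Fin N → ℝ) × ℝ) :
    fderiv ℝ (fun z => truncation ψ v ℓ z ^ (n + 2)) z e =
      (n + 2 : ℕ) * truncation ψ v ℓ z ^ (n + 1) * (fderiv ℝ ψ z e - fderiv ℝ v z e) := by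
  have h1 := (h.contDiff_barrier.differentiable one_ne_zero z).hasFDerivAt
  have h2 := (h.contDiff.differentiable one_ne_zero z).hasFDerivAt
  have h3 : HasFDerivAt (fun z => ψ z - ℓ - v z) (fderiv ℝ ψ z - fderiv ℝ v z) z :=
    (h1.sub_const ℓ).sub h2
  have h4 := (hasDerivAt_max_zero_pow n (ψ z - ℓ - v z)).hasFDerivAt.comp z h3
  have h5 := h4.fderiv
  change fderiv ℝ (fun z => max (ψ z - ℓ - v z) 0 ^ (n + 2)) z = _ at h5
  unfold truncation
  rw [h5]
  simp
  ring

end SmoothData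

/-- The right-hand side density of the energy estimate. -/
noncomputable def energyDensity (p : Fin N → ℝ) (L M ℓ : ℝ) (ψ v : (Fin N → ℝ) × ℝ → ℝ)
    (b : Fin N → (Fin N → ℝ) × ℝ → ℝ) (z : (Fin N → ℝ) × ℝ) : ℝ :=
  {z | v z < ψ z - ℓ}.indicator (fun _ => M ^ 2 * L + ∑ i, M * (2 * L) ^ p i) z +
    (tsupport ψ).indicator (fun z => 2 * M * (L + 1) *
      ∑ i, |b i z - flux (p i) (fderiv ℝ v z (Pi.single i 1, 0))| *
        (1 + |fderiv ℝ v z (Pi.single i 1, 0)|)) z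

theorem continuous_flux {p : ℝ} (hp : 2 ≤ p) : Continuous (flux p) :=
  (continuous_abs.rpow_const fun _ => Or.inr (by linarith)).mul continuous_id

theorem SmoothData.energyDensity_nonneg (h : SmoothData L M T ψ v b) (hM : 0 ≤ M)
    (p : Fin N → ℝ) (z : (Fin N → ℝ) × ℝ) : 0 ≤ energyDensity p L M ℓ ψ v b z := by
  have := h.bound_nonneg
  unfold energyDensity
  refine add_nonneg (indicator_nonneg (fun _ _ => ?_) _) (indicator_nonneg (fun _ _ => ?_) _) <;>
  positivity

theorem SmoothData.integrable_energyDensity (h : SmoothData L M T ψ v b) (hℓ : 0 ≤ ℓ)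
    {p : Fin N → ℝ} (hp : ∀ i, 2 ≤ p i) (t : ℝ) :
    Integrable (energyDensity p L M ℓ ψ v b) (volumeUpTo N t) := by
  have c1 := h.contDiff_barrier.continuous
  have c2 := h.contDiff.continuous
  have c3 := fun i => (h.contDiff_flux i).continuous
  have c4 : ∀ i : Fin N, Continuous fun z => fderiv ℝ v z (Pi.single i 1, 0) := fun i =>
    (h.contDiff.continuous_fderiv one_ne_zero).clm_apply continuous_const
  have c5 := fun i => (continuous_flux (hp i)).comp (c4 i)
  simp only [Function.comp_def] at c5
  refine Integrable.add ?_ ?_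
  · refine (integrable_indicator_iff ?_).2 (integrableOn_const ?_)
    · exact (isOpen_lt c2 (by fun_prop)).measurableSet
    · refine ne_top_of_le_ne_top (h.hasCompactSupport.isCompact.measure_lt_top
        (μ := volumeUpTo N t)).ne (measure_mono fun z hz => ?_)
      by_contra hz'
      have h1 := image_eq_zero_of_notMem_tsupport hz'
      have h2 := h.nonneg z
      have h3 : v z < ψ z - ℓ := hz
      linarith
  · refine (integrable_indicator_iff (isClosed_tsupport ψ).measurableSet).2 ?_
    refine ContinuousOn.integrableOn_compact h.hasCompactSupport.isCompact ?_
    exact Continuous.continuousOn (by fun_prop)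

/-- The energy estimate for smooth approximate super-solutions. -/
theorem SmoothData.energy_estimate (h : SmoothData L M T ψ v b) (hM : 0 ≤ M) (hℓ : 0 ≤ ℓ)
    {p : Fin N → ℝ} (hp : ∀ i, 2 ≤ p i) {t : ℝ} (ht : t ≤ T) :
    (∫ x, truncation ψ v ℓ (x, t) ^ 3) / 3 +
      ∑ i, ∫ z, truncation ψ v ℓ z * |fderiv ℝ v z (Pi.single i 1, 0)| ^ p i ∂volumeUpTo N t ≤
      ∫ z, energyDensity p L M ℓ ψ v b z ∂volumeUpTo N t := by
  set W := truncation ψ v ℓ with hW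
  set μ := volumeUpTo N t with hμ
  have cW : Continuous W := h.continuous_truncation
  have cv : ∀ e, Continuous fun z => fderiv ℝ v z e := fun e =>
    (h.contDiff.continuous_fderiv one_ne_zero).clm_apply continuous_const
  have cψ : ∀ e, Continuous fun z => fderiv ℝ ψ z e := fun e =>
    (h.contDiff_barrier.continuous_fderiv one_ne_zero).clm_apply continuous_const
  have cb : ∀ i, Continuous (b i) := fun i => (h.contDiff_flux i).continuous
  have cb' : ∀ i e, Continuous fun z => fderiv ℝ (b i) z e := fun i e =>
    ((h.contDiff_flux i).continuous_fderiv one_ne_zero).clm_apply continuous_const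
  have cp : ∀ i : Fin N, Continuous fun z => |fderiv ℝ v z (Pi.single i 1, 0)| ^ p i := fun i =>
    (cv _).abs.rpow_const fun _ => Or.inr (by linarith [hp i])
  have s1 : HasCompactSupport W := by simpa using h.hasCompactSupport_truncation_pow hℓ 0
  have s2 : HasCompactSupport fun z => W z ^ 2 := h.hasCompactSupport_truncation_pow hℓ 1
  have i1 : ∀ f : (Fin N → ℝ) × ℝ → ℝ, Continuous f → Integrable (fun z => W z * f z) μ :=
    fun f hf => (cW.mul hf).integrable_of_hasCompactSupport s1.mul_right
  have i2 : ∀ f : (Fin N → ℝ) × ℝ → ℝ, Continuous f → Integrable (fun z => W z ^ 2 * f z) μ :=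
    fun f hf => ((cW.pow 2).mul hf).integrable_of_hasCompactSupport s2.mul_right
  -- The time derivative of `W³/3` is `W²(∂ₜψ - ∂ₜv)`; integrating it up to time `t` produces the
  -- slice term.
  have htime : (∫ x, W (x, t) ^ 3) / 3 =
      ∫ z, W z ^ 2 * (fderiv ℝ ψ z (0, 1) - fderiv ℝ v z (0, 1)) ∂μ := by
    rw [integral_space_eq_integral_time_deriv (h.contDiff_truncation_pow 1)
      (h.hasCompactSupport_truncation_pow hℓ 2), ← integral_div]
    congr 1
    ext z
    rw [h.fderiv_truncation_pow 1]
    push_cast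
    ring
  -- The factor `2` from differentiating `W²` is the one built into `flux_absorption`.
  have hspace : ∀ i, ∫ z, W z ^ 2 * fderiv ℝ (b i) z (Pi.single i 1, 0) ∂μ =
      -∫ z, W z * (2 * (b i z *
        (fderiv ℝ ψ z (Pi.single i 1, 0) - fderiv ℝ v z (Pi.single i 1, 0)))) ∂μ := by
    intro i
    rw [integral_mul_space_fderiv_eq_neg (h.contDiff_truncation_pow 0)
      (h.hasCompactSupport_truncation_pow hℓ 1) (h.contDiff_flux i)]
    congr 2
    ext z
    rw [h.fderiv_truncation_pow 0]
    push_cast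
    ring
  have hle : ∫ z, W z ^ 2 * (fderiv ℝ ψ z (0, 1) - fderiv ℝ v z (0, 1)) ∂μ ≤
      ∫ z, (W z ^ 2 * fderiv ℝ ψ z (0, 1) -
        ∑ i, W z ^ 2 * fderiv ℝ (b i) z (Pi.single i 1, 0)) ∂μ := by
    have hae : ∀ᵐ z ∂μ, z.2 ≤ T := by
      rw [hμ, volumeUpTo_eq]
      filter_upwards [ae_restrict_mem (measurableSet_le measurable_snd measurable_const)] with z hz
      exact le_trans hz ht
    refine integral_mono_ae (i2 _ ((cψ _).sub (cv _)))
      ((i2 _ (cψ _)).sub (integrable_finsetSum _ fun i _ => i2 _ (cb' i _))) ?_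
    filter_upwards [hae] with z hz
    by_cases hzs : z ∈ tsupport ψ
    · have := h.supersolution z hzs hz
      rw [← Finset.mul_sum, ← mul_sub]
      gcongr
    · simp [hW, h.truncation_eq_zero hℓ hzs]
  rw [htime]
  refine (add_le_add_left hle _).trans ?_
  rw [integral_sub (i2 _ (cψ _)) (integrable_finsetSum _ fun i _ => i2 _ (cb' i _)),
    integral_finsetSum _ fun i _ => i2 _ (cb' i _)]
  simp only [hspace]
  rw [Finset.sum_neg_distrib, sub_neg_eq_add, add_assoc, ← Finset.sum_add_distrib]
  have hi3 : ∀ i : Fin N, Integrable (fun z => W z * (2 * (b i z *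
        (fderiv ℝ ψ z (Pi.single i 1, 0) - fderiv ℝ v z (Pi.single i 1, 0))) +
        |fderiv ℝ v z (Pi.single i 1, 0)| ^ p i)) μ := fun i => i1 _ (by
    have := cψ (Pi.single i 1, 0)
    have := cv (Pi.single i 1, 0)
    have := cb i
    have := cp i
    fun_prop)
  have hcomb : ∀ i : Fin N, ∫ z, W z * (2 * (b i z *
        (fderiv ℝ ψ z (Pi.single i 1, 0) - fderiv ℝ v z (Pi.single i 1, 0)))) ∂μ +
      ∫ z, W z * |fderiv ℝ v z (Pi.single i 1, 0)| ^ p i ∂μ =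
      ∫ z, W z * (2 * (b i z *
        (fderiv ℝ ψ z (Pi.single i 1, 0) - fderiv ℝ v z (Pi.single i 1, 0))) +
        |fderiv ℝ v z (Pi.single i 1, 0)| ^ p i) ∂μ := by
    intro i
    rw [← integral_add]
    · simp only [mul_add]
    · refine i1 _ ?_
      have := cψ (Pi.single i 1, 0)
      have := cv (Pi.single i 1, 0)
      have := cb i
      fun_prop
    · exact i1 _ (cp i)
  rw [Finset.sum_congr rfl fun i _ => hcomb i, ← integral_finsetSum _ fun i _ => hi3 i,
    ← integral_add (i2 _ (cψ _)) (integrable_finsetSum _ fun i _ => hi3 i)]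
  refine integral_mono ((i2 _ (cψ _)).add (integrable_finsetSum _ fun i _ => hi3 i))
    (h.integrable_energyDensity hℓ hp t) fun z => ?_
  have hL := h.bound_nonneg
  simp only [energyDensity]
  have hW0 : 0 ≤ W z := truncation_nonneg z
  have hWM : W z ≤ M := h.truncation_le hM hℓ z
  -- Where `W = 0` the integrand vanishes. Elsewhere the point lies in `{v < ψ - ℓ}` and in the
  -- support of `ψ`, so both indicators in the density equal one.
  rcases hW0.eq_or_lt with h0 | hpos
  · have hED := h.energyDensity_nonneg (ℓ := ℓ) hM p z
    refine le_trans (le_of_eq ?_) hED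
    simp [← h0]
  have hmem : v z < ψ z - ℓ := by
    by_contra hcon
    have : W z = 0 := max_eq_right (by linarith)
    linarith
  have hzs : z ∈ tsupport ψ := by
    by_contra hzs
    rw [hW, h.truncation_eq_zero hℓ hzs] at hpos
    exact lt_irrefl _ hpos
  rw [indicator_of_mem (show z ∈ {z | v z < ψ z - ℓ} from hmem), indicator_of_mem hzs, add_assoc,
    Finset.mul_sum, ← Finset.sum_add_distrib]
  refine add_le_add ?_ (Finset.sum_le_sum fun i _ => ?_)
  · have := (le_abs_self _).trans (h.fderiv_time_le z)
    calc W z ^ 2 * fderiv ℝ ψ z (0, 1) ≤ W z ^ 2 * L := by gcongr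
      _ ≤ M ^ 2 * L := by gcongr
  · have hp1 : 1 < p i := by linarith [hp i]
    have key := flux_absorption (b := b i z) (s := fderiv ℝ v z (Pi.single i 1, 0)) hp1 hL
      (h.fderiv_apply_le z i)
    calc _ ≤ W z * ((2 * L) ^ p i + 2 * (L + 1) *
          (|b i z - flux (p i) (fderiv ℝ v z (Pi.single i 1, 0))| *
            (1 + |fderiv ℝ v z (Pi.single i 1, 0)|))) := by gcongr
      _ ≤ M * ((2 * L) ^ p i + 2 * (L + 1) *
          (|b i z - flux (p i) (fderiv ℝ v z (Pi.single i 1, 0))| *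
            (1 + |fderiv ℝ v z (Pi.single i 1, 0)|))) := by gcongr
      _ = _ := by ring

end Smooth

/-! ### Parabolic Sobolev inequality and one iteration step for smooth data. -/

theorem norm_clm_pi_le {N : ℕ} (A : (Fin N → ℝ) →L[ℝ] ℝ) : ‖A‖ ≤ ∑ i, |A (Pi.single i 1)| := by
  refine A.opNorm_le_bound (by positivity) fun x => ?_
  have hx : x = ∑ i, x i • (Pi.single i (1 : ℝ) : Fin N → ℝ) := by
    ext j
    simp [Finset.sum_apply, Pi.single_apply]
  conv_lhs => rw [hx, map_sum]
  refine (norm_sum_le _ _).trans ?_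
  rw [Finset.sum_mul]
  refine Finset.sum_le_sum fun i _ => ?_
  rw [map_smul, norm_smul, mul_comm]
  exact mul_le_mul_of_nonneg_left (norm_le_pi_norm x i) (abs_nonneg _)

/-- Parabolic Sobolev inequality combining a bound on the slices with a bound on the gradient. -/
theorem lintegral_parabolic_sobolev {N : ℕ} (hN : 1 < N) {f : (Fin N → ℝ) × ℝ → ℝ}
    (hf : ContDiff ℝ 1 f) (hfs : HasCompactSupport f) {k : (Fin N → ℝ) × ℝ → ℝ≥0∞}
    (hk : Measurable k) {T : ℝ} {B : ℝ≥0∞} (hB : ∀ t ≤ T, ∫⁻ x, k (x, t) ≤ B) :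
    ∫⁻ z, ‖f z‖ₑ * k z ^ (1 / (N : ℝ)) ∂volumeUpTo N T ≤
      (∫⁻ z, ENNReal.ofReal (∑ i, |fderiv ℝ f z (Pi.single i 1, 0)|) ∂volumeUpTo N T) *
        B ^ (1 / (N : ℝ)) := by
  have hc : ∀ i : Fin N, Continuous fun z => fderiv ℝ f z (Pi.single i 1, 0) := fun i =>
    (hf.continuous_fderiv one_ne_zero).clm_apply continuous_const
  have hd := hf.differentiable one_ne_zero
  have m1 : Measurable fun z => ‖f z‖ₑ * k z ^ (1 / (N : ℝ)) :=
    hf.continuous.enorm.measurable.mul (hk.pow_const _)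
  have m2 : Measurable fun z => ENNReal.ofReal (∑ i, |fderiv ℝ f z (Pi.single i 1, 0)|) :=
    (continuous_finsetSum _ fun i _ => (hc i).abs).measurable.ennreal_ofReal
  rw [volumeUpTo, lintegral_prod_symm _ m1.aemeasurable, lintegral_prod_symm _ m2.aemeasurable,
    ← lintegral_mul_const _ m2.lintegral_prod_left']
  refine lintegral_mono_ae ?_
  filter_upwards [ae_restrict_mem measurableSet_Iic] with t ht
  have h1 : ContDiff ℝ 1 fun x => f (x, t) := hf.comp (by fun_prop)
  refine (lintegral_mul_rpow_le_sobolev hN h1 (hasCompactSupport_space_slice hfs t)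
    (hk.comp measurable_prodMk_right)).trans ?_
  gcongr with x
  · rw [← ofReal_norm]
    refine ENNReal.ofReal_le_ofReal ((norm_clm_pi_le _).trans (le_of_eq ?_))
    simp only [fderiv_space_slice (hd _)]
  · exact hB t ht

variable {N : ℕ} {L M T ℓ : ℝ} {ψ v : (Fin N → ℝ) × ℝ → ℝ} {b : Fin N → (Fin N → ℝ) × ℝ → ℝ}

/-- One step of the iteration for smooth approximate super-solutions. -/
theorem SmoothData.lintegral_truncation_le (h : SmoothData L M T ψ v b) (hN : 1 < N)
    (hL : 1 ≤ L) (hM : 0 < M) (hℓ : 0 ≤ ℓ) {p : Fin N → ℝ} (hp : ∀ i, 2 ≤ p i) :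
    ∫⁻ z, ENNReal.ofReal (truncation ψ v ℓ z ^ (2 + 3 / (N : ℝ))) ∂volumeUpTo N T ≤
      ENNReal.ofReal (2 * N * (L + 1) / M + 2) *
        (∫⁻ z, ENNReal.ofReal (energyDensity p L M ℓ ψ v b z) ∂volumeUpTo N T) *
        (3 * ∫⁻ z, ENNReal.ofReal (energyDensity p L M ℓ ψ v b z) ∂volumeUpTo N T) ^
          (1 / (N : ℝ)) := by
  set W := truncation ψ v ℓ with hW
  set μ := volumeUpTo N T with hμ
  set D := energyDensity p L M ℓ ψ v b with hD
  have cW : Continuous W := h.continuous_truncation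
  have cv : ∀ i : Fin N, Continuous fun z => fderiv ℝ v z (Pi.single i 1, 0) := fun i =>
    (h.contDiff.continuous_fderiv one_ne_zero).clm_apply continuous_const
  have cp : ∀ i : Fin N, Continuous fun z => |fderiv ℝ v z (Pi.single i 1, 0)| ^ p i := fun i =>
    (cv _).abs.rpow_const fun _ => Or.inr (by linarith [hp i])
  have hW0 : ∀ z, 0 ≤ W z := truncation_nonneg
  have s1 : HasCompactSupport W := by simpa using h.hasCompactSupport_truncation_pow hℓ 0
  have i1 : ∀ t, ∀ f : (Fin N → ℝ) × ℝ → ℝ, Continuous f →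
      Integrable (fun z => W z * f z) (volumeUpTo N t) :=
    fun t f hf => (cW.mul hf).integrable_of_hasCompactSupport s1.mul_right
  have iD : ∀ t, Integrable D (volumeUpTo N t) := h.integrable_energyDensity hℓ hp
  have hD0 : ∀ z, 0 ≤ D z := h.energyDensity_nonneg hM.le p
  have hDμ : ENNReal.ofReal (∫ z, D z ∂μ) = ∫⁻ z, ENNReal.ofReal (D z) ∂μ :=
    ofReal_integral_eq_lintegral_ofReal (iD T) (Eventually.of_forall hD0)
  have hslice : ∀ t ≤ T, ∫⁻ x, ENNReal.ofReal (W (x, t) ^ 3) ≤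
      3 * ∫⁻ z, ENNReal.ofReal (D z) ∂μ := by
    intro t ht
    have hi : Integrable (fun x => W (x, t) ^ 3) :=
      Continuous.integrable_of_hasCompactSupport (by fun_prop)
        (hasCompactSupport_space_slice (h.hasCompactSupport_truncation_pow hℓ 2) t)
    rw [← ofReal_integral_eq_lintegral_ofReal hi
      (Eventually.of_forall fun x => pow_nonneg (hW0 _) 3), ← hDμ,
      ← ENNReal.ofReal_ofNat 3, ← ENNReal.ofReal_mul (by norm_num)]
    refine ENNReal.ofReal_le_ofReal ?_
    have h1 := h.energy_estimate hM.le hℓ hp ht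
    have h2 : 0 ≤ ∑ i, ∫ z, W z * |fderiv ℝ v z (Pi.single i 1, 0)| ^ p i ∂volumeUpTo N t :=
      Finset.sum_nonneg fun i _ => integral_nonneg fun z =>
        mul_nonneg (hW0 z) (by positivity)
    have h3 : ∫ z, D z ∂volumeUpTo N t ≤ ∫ z, D z ∂μ := by
      refine integral_mono_measure ?_ (Eventually.of_forall hD0) (iD T)
      rw [hμ, volumeUpTo_eq, volumeUpTo_eq]
      exact Measure.restrict_mono (fun z hz => le_trans hz ht) le_rfl
    linarith
  have hgrad : ∫⁻ z, ENNReal.ofReal (∑ i, |fderiv ℝ (fun z => W z ^ 2) z (Pi.single i 1, 0)|) ∂μ ≤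
      ENNReal.ofReal (2 * N * (L + 1) / M + 2) * ∫⁻ z, ENNReal.ofReal (D z) ∂μ := by
    have hpt : ∀ z, ∑ i, |fderiv ℝ (fun z => W z ^ 2) z (Pi.single i 1, 0)| ≤
        2 * N * (L + 1) / M * D z +
          ∑ i, 2 * (W z * |fderiv ℝ v z (Pi.single i 1, 0)| ^ p i) := by
      intro z
      -- Where `W > 0` the density is at least `M²L ≥ M²`, by `L ≥ 1`, while `W ≤ M`. Hence the term
      -- `2(L+1)W` of the gradient bound is absorbed into the density.
      have hWD : W z ≤ D z / M := by
        rcases (hW0 z).eq_or_lt with h0 | hpos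
        · rw [← h0]
          exact div_nonneg (hD0 z) hM.le
        · have hmem : v z < ψ z - ℓ := by
            by_contra hcon
            have : W z = 0 := max_eq_right (by linarith)
            linarith
          rw [le_div_iff₀ hM]
          have h1 : 0 ≤ (tsupport ψ).indicator (fun z => 2 * M * (L + 1) *
              ∑ i, |b i z - flux (p i) (fderiv ℝ v z (Pi.single i 1, 0))| *
                (1 + |fderiv ℝ v z (Pi.single i 1, 0)|)) z :=
            indicator_nonneg (fun _ _ => by positivity) _
          change W z * M ≤ energyDensity p L M ℓ ψ v b z
          rw [energyDensity, indicator_of_mem (show z ∈ {z | v z < ψ z - ℓ} from hmem)]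
          have h3 : 0 ≤ ∑ i, M * (2 * L) ^ p i := by positivity
          have h4 : W z ≤ M := h.truncation_le hM.le hℓ z
          have h5 : W z * M ≤ M * M := by gcongr
          nlinarith [sq_nonneg M]
      have hi : ∀ i, |fderiv ℝ (fun z => W z ^ 2) z (Pi.single i 1, 0)| ≤
          2 * (L + 1) * W z + 2 * (W z * |fderiv ℝ v z (Pi.single i 1, 0)| ^ p i) := by
        intro i
        have h0 := h.fderiv_truncation_pow (ℓ := ℓ) 0 z (Pi.single i 1, 0)
        simp only [zero_add, pow_one] at h0
        rw [hW, h0, abs_mul, abs_mul, abs_of_nonneg (hW0 z)]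
        have h1 := le_one_add_rpow (abs_nonneg (fderiv ℝ v z (Pi.single i 1, 0))) zero_le_one
          (by linarith [hp i] : (1 : ℝ) ≤ p i)
        rw [Real.rpow_one] at h1
        have h2 := abs_sub (fderiv ℝ ψ z (Pi.single i 1, 0)) (fderiv ℝ v z (Pi.single i 1, 0))
        have h3 := h.fderiv_apply_le z i
        have h4 : |fderiv ℝ ψ z (Pi.single i 1, 0) - fderiv ℝ v z (Pi.single i 1, 0)| ≤
          (L + 1) + |fderiv ℝ v z (Pi.single i 1, 0)| ^ p i := by linarith
        calc _ ≤ |((2 : ℕ) : ℝ)| * W z *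
              ((L + 1) + |fderiv ℝ v z (Pi.single i 1, 0)| ^ p i) := by
              gcongr
              exact mul_nonneg (abs_nonneg _) (hW0 z)
          _ = _ := by norm_num; ring
      calc _ ≤ ∑ i : Fin N, (2 * (L + 1) * W z +
              2 * (W z * |fderiv ℝ v z (Pi.single i 1, 0)| ^ p i)) :=
            Finset.sum_le_sum fun i _ => hi i
        _ = 2 * N * (L + 1) * W z +
              ∑ i, 2 * (W z * |fderiv ℝ v z (Pi.single i 1, 0)| ^ p i) := by
            rw [Finset.sum_add_distrib, Finset.sum_const, Finset.card_univ, Fintype.card_fin,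
              nsmul_eq_mul]
            ring
        _ ≤ 2 * N * (L + 1) * (D z / M) +
              ∑ i, 2 * (W z * |fderiv ℝ v z (Pi.single i 1, 0)| ^ p i) := by gcongr
        _ = _ := by ring
    have hI : ∀ i, Integrable
        (fun z => 2 * (W z * |fderiv ℝ v z (Pi.single i 1, 0)| ^ p i)) μ := fun i =>
      (i1 T _ (cp i)).const_mul 2
    have hI' := ((iD T).const_mul (2 * N * (L + 1) / M)).add
      (integrable_finsetSum Finset.univ fun i _ => hI i)
    calc _ ≤ ∫⁻ z, ENNReal.ofReal (2 * N * (L + 1) / M * D z +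
          ∑ i, 2 * (W z * |fderiv ℝ v z (Pi.single i 1, 0)| ^ p i)) ∂μ := by
          gcongr with z
          exact hpt z
      _ = ENNReal.ofReal (∫ z, (2 * N * (L + 1) / M * D z +
          ∑ i, 2 * (W z * |fderiv ℝ v z (Pi.single i 1, 0)| ^ p i)) ∂μ) := by
          refine (ofReal_integral_eq_lintegral_ofReal hI' (Eventually.of_forall fun z => ?_)).symm
          exact (Finset.sum_nonneg fun i _ => abs_nonneg _).trans (hpt z)
      _ ≤ ENNReal.ofReal ((2 * N * (L + 1) / M + 2) * ∫ z, D z ∂μ) := by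
          refine ENNReal.ofReal_le_ofReal ?_
          rw [integral_add ((iD T).const_mul _) (integrable_finsetSum _ fun i _ => hI i),
            integral_finsetSum _ fun i _ => hI i, integral_const_mul]
          simp only [integral_const_mul]
          rw [← Finset.mul_sum]
          have h1 := h.energy_estimate hM.le hℓ hp le_rfl
          have h2 : 0 ≤ (∫ x, W (x, T) ^ 3) / 3 :=
            div_nonneg (integral_nonneg fun x => pow_nonneg (hW0 _) 3) (by norm_num)
          nlinarith
      _ = _ := by
          rw [ENNReal.ofReal_mul (by positivity), hDμ]
  -- Applied to `f = W²` with weight `W³`; the exponent `2 + 3/N` is that of `W² (W³)^{1/N}`.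
  have hmain := lintegral_parabolic_sobolev hN (h.contDiff_truncation_pow (ℓ := ℓ) 0)
    (h.hasCompactSupport_truncation_pow hℓ 1) (k := fun z => ENNReal.ofReal (W z ^ 3))
    (by fun_prop) hslice
  refine le_trans (le_of_eq ?_) (hmain.trans (mul_le_mul_left hgrad _))
  congr 1
  ext z
  have hz := hW0 z
  rw [Real.enorm_eq_ofReal (by positivity), ENNReal.ofReal_rpow_of_nonneg (by positivity)
    (by positivity), ← ENNReal.ofReal_mul (by positivity), ← Real.rpow_natCast,
    ← Real.rpow_natCast, ← Real.rpow_mul hz, ← Real.rpow_add' hz (by positivity)]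
  congr 2
  push_cast
  ring

/-! ### Mollification and the flux commutator. -/

section Mollification

set_option linter.unusedSectionVars false

variable {G : Type*} [NormedAddCommGroup G] [NormedSpace ℝ G] [FiniteDimensional ℝ G]
  [MeasurableSpace G] [BorelSpace G] {μ : Measure G} [μ.IsAddHaarMeasure]

/-- Mollification of `f` by the normed bump function `φ`. -/
noncomputable def mollify (μ : Measure G) (φ : ContDiffBump (0 : G)) (f : G → ℝ) : G → ℝ :=
  convolution (φ.normed μ) f (ContinuousLinearMap.lsmul ℝ ℝ) μ

theorem mollify_apply (φ : ContDiffBump (0 : G)) (f : G → ℝ) (z : G) :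
    mollify μ φ f z = ∫ y, φ.normed μ (z - y) * f y ∂μ := by
  rw [mollify, convolution_lsmul_swap]
  simp only [smul_eq_mul]

theorem contDiff_mollify (φ : ContDiffBump (0 : G)) {f : G → ℝ} (hf : Integrable f μ) :
    ContDiff ℝ 1 (mollify μ φ f) :=
  φ.hasCompactSupport_normed.contDiff_convolution_left (n := 1) _ φ.contDiff_normed
    hf.locallyIntegrable

theorem mollify_nonneg (φ : ContDiffBump (0 : G)) {f : G → ℝ} (hf : ∀ᵐ z ∂μ, 0 ≤ f z) (z : G) :
    0 ≤ mollify μ φ f z := by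
  rw [mollify_apply]
  refine integral_nonneg_of_ae ?_
  filter_upwards [hf] with y hy
  exact mul_nonneg (φ.nonneg_normed _) hy

theorem integrable_comp_sub_mul {k : G → ℝ} (hk : Continuous k) (hks : HasCompactSupport k)
    {f : G → ℝ} (hf : Integrable f μ) (z : G) : Integrable (fun y => k (z - y) * f y) μ := by
  obtain ⟨C, hC⟩ := hks.exists_bound_of_continuous hk
  exact hf.bdd_mul (hk.comp (by fun_prop)).aestronglyMeasurable
    (Eventually.of_forall fun y => hC (z - y))

theorem fderiv_mollify (φ : ContDiffBump (0 : G)) {f : G → ℝ} (hf : Integrable f μ) (z e : G) :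
    fderiv ℝ (mollify μ φ f) z e = ∫ y, fderiv ℝ (φ.normed μ) (z - y) e * f y ∂μ := by
  have hφ : ContDiff ℝ 1 (φ.normed μ) := φ.contDiff_normed (n := 1)
  have h := φ.hasCompactSupport_normed.hasFDerivAt_convolution_left (μ := μ)
    (ContinuousLinearMap.lsmul ℝ ℝ) hφ hf.locallyIntegrable z
  rw [mollify, h.fderiv, convolution_eq_swap, ContinuousLinearMap.integral_apply]
  · rfl
  · have hc : HasCompactSupport (fderiv ℝ (φ.normed μ)) := φ.hasCompactSupport_normed.fderiv ℝ
    exact ((hc.convolutionExists_left _ (hφ.continuous_fderiv one_ne_zero)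
      hf.locallyIntegrable) z).integrable_swap

theorem integrable_mollify (φ : ContDiffBump (0 : G)) {f : G → ℝ} (hf : Integrable f μ) :
    Integrable (mollify μ φ f) μ :=
  (φ.integrable_normed).integrable_convolution _ hf

theorem integral_mollify (φ : ContDiffBump (0 : G)) {f : G → ℝ} (hf : Integrable f μ) :
    ∫ z, mollify μ φ f z ∂μ = ∫ z, f z ∂μ := by
  rw [mollify, integral_convolution _ φ.integrable_normed hf, φ.integral_normed]
  simp

/-- Jensen's inequality for mollification. -/
theorem abs_mollify_rpow_le (φ : ContDiffBump (0 : G)) {p q : ℝ} (hpq : p.HolderConjugate q)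
    {f : G → ℝ} (hf : Integrable f μ) (hfp : Integrable (fun z => |f z| ^ p) μ) (z : G) :
    |mollify μ φ f z| ^ p ≤ mollify μ φ (fun z => |f z| ^ p) z := by
  set c := mollify μ φ (fun z => |f z|) z with hc
  have hφ : Continuous (φ.normed μ) := (φ.contDiff_normed (n := 1)).continuous
  have hφs := φ.hasCompactSupport_normed (μ := μ)
  have hp0 := hpq.pos
  have hq0 := hpq.symm.pos
  have hc0 : 0 ≤ c := mollify_nonneg φ (Eventually.of_forall fun z => abs_nonneg _) z
  have hle : |mollify μ φ f z| ≤ c := by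
    rw [hc, mollify_apply, mollify_apply]
    refine (abs_integral_le_integral_abs).trans (le_of_eq ?_)
    congr 1
    ext y
    rw [abs_mul, abs_of_nonneg (φ.nonneg_normed _)]
  have hone : ∫ y, φ.normed μ (z - y) ∂μ = 1 := by
    rw [integral_sub_left_eq_self (φ.normed μ) μ z, φ.integral_normed]
  have hi1 : Integrable (fun y => φ.normed μ (z - y)) μ :=
    φ.integrable_normed.comp_sub_left z
  -- Young's inequality between `|f y|` and the constant `c^{p-1}`, averaged against the bump. The
  -- term `c^p / q` is then absorbed on the left because `1 - 1/q = 1/p`.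
  have key : c * c ^ (p - 1) ≤ mollify μ φ (fun z => |f z| ^ p) z / p + c ^ p / q := by
    have hi2 := integrable_comp_sub_mul hφ hφs hfp z
    calc c * c ^ (p - 1) = ∫ y, φ.normed μ (z - y) * |f y| * c ^ (p - 1) ∂μ := by
          rw [integral_mul_const, ← mollify_apply]
      _ ≤ ∫ y, (φ.normed μ (z - y) * |f y| ^ p / p + φ.normed μ (z - y) * (c ^ p / q)) ∂μ := by
          refine integral_mono ((integrable_comp_sub_mul hφ hφs hf.abs z).mul_const _)
            ((hi2.div_const _).add (hi1.mul_const _)) fun y => ?_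
          have h1 := Real.young_inequality (|f y|) (c ^ (p - 1)) hpq
          rw [abs_abs, abs_of_nonneg (by positivity : 0 ≤ c ^ (p - 1)), ← Real.rpow_mul hc0,
            hpq.sub_one_mul_conj] at h1
          calc _ = φ.normed μ (z - y) * (|f y| * c ^ (p - 1)) := by ring
            _ ≤ φ.normed μ (z - y) * (|f y| ^ p / p + c ^ p / q) :=
              mul_le_mul_of_nonneg_left h1 (φ.nonneg_normed _)
            _ = _ := by ring
      _ = _ := by
          rw [integral_add (hi2.div_const _) (hi1.mul_const _), integral_div, integral_mul_const,
            hone, one_mul, ← mollify_apply]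
  have hcp : c * c ^ (p - 1) = c ^ p := by
    rw [mul_comm, ← Real.rpow_add_one' hc0 (by linarith)]
    ring_nf
  rw [hcp] at key
  have hsum := hpq.inv_add_inv_eq_one
  calc |mollify μ φ f z| ^ p ≤ c ^ p := by gcongr
    _ = p * (c ^ p - c ^ p / q) := by
      have : c ^ p - c ^ p / q = c ^ p * p⁻¹ := by
        have : q⁻¹ = 1 - p⁻¹ := by linarith
        rw [div_eq_mul_inv, this]
        ring
      rw [this]
      field_simp
    _ ≤ p * (mollify μ φ (fun z => |f z| ^ p) z / p) := by gcongr; linarith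
    _ = _ := by field_simp

/-- A sequence of bump functions shrinking to the origin. -/
noncomputable def shrinkingBump (G : Type*) [NormedAddCommGroup G] (j : ℕ) :
    ContDiffBump (0 : G) where
  -- The ratio of the two radii stays equal to `2`; a bounded ratio is what almost everywhere
  -- convergence of the mollifications requires.
  rIn := 1 / (2 * (j + 1))
  rOut := 1 / (j + 1)
  rIn_pos := by positivity
  rIn_lt_rOut := by
    rw [div_lt_div_iff₀ (by positivity) (by positivity)]
    have : (0 : ℝ) ≤ j := by positivity
    linarith

theorem tendsto_shrinkingBump_rOut :
    Tendsto (fun j => (shrinkingBump G j).rOut) atTop (𝓝 0) :=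
  tendsto_one_div_add_atTop_nhds_zero_nat

theorem ae_tendsto_mollify {f : G → ℝ} (hf : Integrable f μ) :
    ∀ᵐ z ∂μ, Tendsto (fun j => mollify μ (shrinkingBump G j) f z) atTop (𝓝 (f z)) := by
  refine ContDiffBump.ae_convolution_tendsto_right_of_locallyIntegrable (K := 2)
    tendsto_shrinkingBump_rOut (Eventually.of_forall fun j => ?_) hf.locallyIntegrable
  change (1 : ℝ) / (j + 1) ≤ 2 * (1 / (2 * (j + 1)))
  exact le_of_eq (by field_simp)

/-- Scheffé's argument. Mollification preserves the integral, so the positive and negative parts of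
the difference have equal integrals. The negative part is dominated by `h`, so dominated convergence
applies to it. -/
theorem tendsto_lintegral_mollify_sub_pos {h : G → ℝ} (hh : Integrable h μ)
    (h0 : ∀ z, 0 ≤ h z) :
    Tendsto (fun j => ∫⁻ z, ENNReal.ofReal (mollify μ (shrinkingBump G j) h z - h z) ∂μ)
      atTop (𝓝 0) := by
  have hm := fun j => integrable_mollify (shrinkingBump G j) hh
  have hm0 : ∀ j z, 0 ≤ mollify μ (shrinkingBump G j) h z := fun j z =>
    mollify_nonneg _ (Eventually.of_forall h0) z
  have heq : ∀ j, ∫⁻ z, ENNReal.ofReal (mollify μ (shrinkingBump G j) h z - h z) ∂μ =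
      ∫⁻ z, ENNReal.ofReal (h z - mollify μ (shrinkingBump G j) h z) ∂μ := by
    intro j
    have hA := (hm j).sub hh
    have h1 := integral_eq_lintegral_pos_part_sub_lintegral_neg_part hA
    have h2 : ∫ z, (mollify μ (shrinkingBump G j) h - h) z ∂μ = 0 := by
      simp only [Pi.sub_apply]
      rw [integral_sub (hm j) hh, integral_mollify _ hh, sub_self]
    rw [h2] at h1
    simp only [Pi.sub_apply, neg_sub] at h1
    refine (ENNReal.toReal_eq_toReal_iff' ?_ ?_).1 (sub_eq_zero.1 h1.symm)
    · exact ((hm j).sub hh).lintegral_lt_top.ne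
    · exact (hh.sub (hm j)).lintegral_lt_top.ne
  simp only [heq]
  have := tendsto_lintegral_of_dominated_convergence' (μ := μ)
    (F := fun j z => ENNReal.ofReal (h z - mollify μ (shrinkingBump G j) h z)) (f := fun _ => 0)
    (fun z => ENNReal.ofReal (h z))
    (fun j => (hh.aemeasurable.sub (hm j).aemeasurable).ennreal_ofReal)
    (fun j => Eventually.of_forall fun z => ENNReal.ofReal_le_ofReal (by linarith [hm0 j z]))
    hh.lintegral_lt_top.ne ?_
  · simpa using this
  · filter_upwards [ae_tendsto_mollify hh] with z hz
    have := ENNReal.tendsto_ofReal (hz.const_sub (h z))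
    simpa using this

/-- The commutator between mollification and the flux tends to zero. -/
theorem tendsto_lintegral_flux_commutator {p : ℝ} (hp : 2 ≤ p) {g : G → ℝ} (hg : Integrable g μ)
    (hgp : Integrable (fun z => |g z| ^ p) μ) (hfl : Integrable (fun z => flux p (g z)) μ)
    {S : Set G} (hSμ : μ S ≠ ⊤) :
    Tendsto (fun j => ∫⁻ z in S, ENNReal.ofReal
      (|mollify μ (shrinkingBump G j) (fun z => flux p (g z)) z -
          flux p (mollify μ (shrinkingBump G j) g z)| *
        (1 + |mollify μ (shrinkingBump G j) g z|)) ∂μ) atTop (𝓝 0) := by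
  have hp1 : 1 < p := by linarith
  have hconj := Real.HolderConjugate.conjExponent hp1
  set q := Real.conjExponent p with hq
  set h : G → ℝ := fun z => |g z| ^ p with hh
  have hh0 : ∀ z, 0 ≤ h z := fun z => by positivity
  set gm := fun j => mollify μ (shrinkingBump G j) g with hgm
  set am := fun j => mollify μ (shrinkingBump G j) (fun z => flux p (g z)) with ham
  set hm := fun j => mollify μ (shrinkingBump G j) h with hhm
  set e := fun j z => |am j z - flux p (gm j z)| * (1 + |gm j z|) with he
  have hflq : (fun z => |flux p (g z)| ^ q) = h := by
    ext z
    rw [abs_flux hp1, ← Real.rpow_mul (abs_nonneg _), hconj.sub_one_mul_conj]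
  have hg1 : ∀ j z, |gm j z| ^ p ≤ hm j z := fun j z => abs_mollify_rpow_le _ hconj hg hgp z
  have ha1 : ∀ j z, |am j z| ^ q ≤ hm j z := fun j z => by
    have := abs_mollify_rpow_le (μ := μ) (shrinkingBump G j) hconj.symm hfl
      (by rw [hflq]; exact hgp) z
    rwa [hflq] at this
  have hcg : ∀ j, Continuous (gm j) := fun j => (contDiff_mollify _ hg).continuous
  have hca : ∀ j, Continuous (am j) := fun j => (contDiff_mollify _ hfl).continuous
  have hch : ∀ j, Continuous (hm j) := fun j => (contDiff_mollify _ hgp).continuous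
  have hce : ∀ j, Continuous (e j) := fun j => by
    have := (continuous_flux hp).comp (hcg j)
    have := hcg j
    have := hca j
    simp only [Function.comp_def] at *
    simp only [he]
    fun_prop
  -- Jensen's inequality for the gradient with exponent `p`, and for the flux with the conjugate
  -- exponent `q`, bounds both by the same mollified function, since `|flux p (g z)|^q = |g z|^p`.
  have hbound : ∀ j z, e j z ≤ 5 * (1 + hm j z) := by
    intro j z
    have hX := abs_nonneg (gm j z)
    have hA := abs_nonneg (am j z)
    set X := |gm j z|
    set A := |am j z|
    have h1 : |am j z - flux p (gm j z)| ≤ A + X ^ (p - 1) := by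
      rw [← abs_flux hp1]
      exact abs_sub _ _
    have h2 : A * X ≤ A ^ q + X ^ p := by
      have := Real.young_inequality_of_nonneg hA hX hconj.symm
      have h3 : A ^ q / q ≤ A ^ q := div_le_self (by positivity) hconj.symm.lt.le
      have h4 : X ^ p / p ≤ X ^ p := div_le_self (by positivity) hp1.le
      linarith
    have h3 := le_one_add_rpow hA zero_le_one hconj.symm.lt.le
    rw [Real.rpow_one] at h3
    have h4 := le_one_add_rpow hX (by linarith : 0 ≤ p - 1) (by linarith : p - 1 ≤ p)
    have h5 : X ^ (p - 1) * X = X ^ p := by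
      rw [← Real.rpow_add_one' hX (by linarith)]
      ring_nf
    have h6 := hg1 j z
    have h7 := ha1 j z
    calc e j z ≤ (A + X ^ (p - 1)) * (1 + X) := by
          simp only [he]
          gcongr
      _ = A + A * X + X ^ (p - 1) + X ^ (p - 1) * X := by ring
      _ ≤ _ := by
          have h8 : 0 ≤ hm j z := mollify_nonneg _ (Eventually.of_forall hh0) z
          linarith
  -- The bound above moves with `j`, so it is no dominating function. Capping `e j` at `5(1 + h)`
  -- gives a dominated sequence, and the excess is at most `5(hm j - h)₊`, which Scheffé's argument
  -- handles.
  have hsplit : ∀ j, ∫⁻ z in S, ENNReal.ofReal (e j z) ∂μ ≤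
      (∫⁻ z in S, ENNReal.ofReal (min (e j z) (5 * (1 + h z))) ∂μ) +
        ENNReal.ofReal 5 * ∫⁻ z, ENNReal.ofReal (hm j z - h z) ∂μ := by
    intro j
    have hmeas : AEMeasurable (fun z => ENNReal.ofReal (hm j z - h z)) μ :=
      ((hch j).aemeasurable.sub hgp.aemeasurable).ennreal_ofReal
    rw [← lintegral_const_mul'' _ hmeas]
    refine le_trans ?_ (add_le_add_right (setLIntegral_le_lintegral S _) _)
    rw [← lintegral_add_right' _ (hmeas.const_mul _).restrict]
    refine lintegral_mono fun z => ?_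
    rw [← ENNReal.ofReal_mul (by norm_num)]
    rcases le_total (e j z) (5 * (1 + h z)) with hle | hle
    · rw [min_eq_left hle]
      exact le_self_add
    · rw [min_eq_right hle, ← ENNReal.ofReal_add (by linarith [hh0 z])]
      · exact ENNReal.ofReal_le_ofReal (by linarith [hbound j z])
      · linarith [hbound j z]
  have hlim1 : Tendsto (fun j => ∫⁻ z in S, ENNReal.ofReal (min (e j z) (5 * (1 + h z))) ∂μ)
      atTop (𝓝 0) := by
    have hI : IntegrableOn (fun z => 5 * (1 + h z)) S μ :=
      ((integrableOn_const hSμ).add hgp.integrableOn).const_mul 5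
    have := tendsto_lintegral_of_dominated_convergence' (μ := μ.restrict S)
      (F := fun j z => ENNReal.ofReal (min (e j z) (5 * (1 + h z)))) (f := fun _ => 0)
      (fun z => ENNReal.ofReal (5 * (1 + h z)))
      (fun j => ((hce j).aemeasurable.min hI.aemeasurable).ennreal_ofReal)
      (fun j => Eventually.of_forall fun z => ENNReal.ofReal_le_ofReal (min_le_right _ _))
      hI.lintegral_lt_top.ne ?_
    · simpa using this
    · refine ae_restrict_of_ae ?_
      filter_upwards [ae_tendsto_mollify hg, ae_tendsto_mollify hfl] with z hz1 hz2
      have h1 : Tendsto (fun j => e j z) atTop (𝓝 0) := by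
        have h2 := ((continuous_flux hp).tendsto _).comp hz1
        have h3 := (hz2.sub h2).abs.mul (hz1.abs.const_add 1)
        simpa using h3
      have h4 := ENNReal.tendsto_ofReal (h1.min (tendsto_const_nhds (x := 5 * (1 + h z))))
      rwa [min_eq_left (by linarith [hh0 z]), ENNReal.ofReal_zero] at h4
  have hlim2 := (tendsto_lintegral_mollify_sub_pos hgp hh0)
  have hlim3 := ENNReal.Tendsto.const_mul (a := ENNReal.ofReal 5) hlim2
    (Or.inr ENNReal.ofReal_ne_top)
  have hlim := hlim1.add hlim3
  rw [mul_zero, add_zero] at hlim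
  exact tendsto_of_tendsto_of_tendsto_of_le_of_le tendsto_const_nhds hlim
    (fun _ => zero_le) hsplit

end Mollification

/-! ### Distributional super-solutions and the equation of their mollifications. -/

instance (N : ℕ) : (volume : Measure ((Fin N → ℝ) × ℝ)).IsAddHaarMeasure :=
  inferInstanceAs
    (((volume : Measure (Fin N → ℝ)).prod (volume : Measure ℝ)).IsAddHaarMeasure)

/-- Super-solutions in the sense of distributions in the unit ball of `ℝᴺ × ℝ` for the supremum
norm, which is the cylinder `(-1,1)ᴺ × (-1,1)`; `g i` stands for `∂ᵢv`. -/
structure IsDistributionalSuperSolution {N : ℕ} (p : Fin N → ℝ) (v : (Fin N → ℝ) × ℝ → ℝ)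
    (g : Fin N → (Fin N → ℝ) × ℝ → ℝ) : Prop where
  integrableOn : ∀ r < 1, IntegrableOn v (Metric.closedBall 0 r)
  integrableOn_deriv : ∀ i, ∀ r < 1, IntegrableOn (g i) (Metric.closedBall 0 r)
  integrableOn_rpow : ∀ i, ∀ r < 1, IntegrableOn (fun z => |g i z| ^ p i) (Metric.closedBall 0 r)
  integral_deriv : ∀ i, ∀ φ : (Fin N → ℝ) × ℝ → ℝ, ContDiff ℝ ∞ φ → HasCompactSupport φ →
    tsupport φ ⊆ Metric.ball 0 1 →
      ∫ z, v z * fderiv ℝ φ z (Pi.single i 1, 0) = -∫ z, g i z * φ z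
  integral_nonneg : ∀ φ : (Fin N → ℝ) × ℝ → ℝ, ContDiff ℝ ∞ φ → HasCompactSupport φ →
    tsupport φ ⊆ Metric.ball 0 1 → (∀ z, 0 ≤ φ z) →
      0 ≤ ∫ z, (-(v z * fderiv ℝ φ z (0, 1)) +
        ∑ i, flux (p i) (g i z) * fderiv ℝ φ z (Pi.single i 1, 0))

theorem flux_zero (p : ℝ) : flux p 0 = 0 := by simp [flux]

theorem integrable_flux {α : Type*} [MeasurableSpace α] {μ : Measure α} [IsFiniteMeasure μ] {p : ℝ}
    (hp : 2 ≤ p) {f : α → ℝ} (hf : AEStronglyMeasurable f μ)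
    (hfp : Integrable (fun z => |f z| ^ p) μ) : Integrable (fun z => flux p (f z)) μ := by
  refine ((integrable_const (1 : ℝ)).add hfp).mono'
    ((continuous_flux hp).comp_aestronglyMeasurable hf) (Eventually.of_forall fun z => ?_)
  rw [Real.norm_eq_abs, abs_flux (by linarith)]
  exact le_one_add_rpow (abs_nonneg _) (by linarith) (by linarith)

section Reflection

variable {N : ℕ} (φ : ContDiffBump (0 : (Fin N → ℝ) × ℝ)) (z : (Fin N → ℝ) × ℝ)

/-- The bump function `φ` reflected and centred at `z`. -/
noncomputable def reflectedBump (y : (Fin N → ℝ) × ℝ) : ℝ := φ.normed volume (z - y)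

theorem contDiff_reflectedBump : ContDiff ℝ ∞ (reflectedBump φ z) :=
  (φ.contDiff_normed (n := ⊤)).comp (contDiff_const.sub contDiff_id)

theorem support_reflectedBump : Function.support (reflectedBump φ z) ⊆ Metric.ball z φ.rOut := by
  intro y hy
  have h1 : z - y ∈ Function.support (φ.normed volume) := hy
  rw [φ.support_normed_eq] at h1
  rw [Metric.mem_ball, dist_comm, dist_eq_norm]
  simpa using h1

theorem tsupport_reflectedBump :
    tsupport (reflectedBump φ z) ⊆ Metric.closedBall z φ.rOut :=
  closure_minimal ((support_reflectedBump φ z).trans Metric.ball_subset_closedBall)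
    Metric.isClosed_closedBall

theorem hasCompactSupport_reflectedBump : HasCompactSupport (reflectedBump φ z) :=
  HasCompactSupport.intro (isCompact_closedBall z φ.rOut) fun y hy => by
    by_contra h
    exact hy (tsupport_reflectedBump φ z (subset_tsupport _ h))

theorem fderiv_reflectedBump (y e : (Fin N → ℝ) × ℝ) :
    fderiv ℝ (reflectedBump φ z) y e = -fderiv ℝ (φ.normed volume) (z - y) e := by
  have h1 : DifferentiableAt ℝ (φ.normed volume) (z - y) :=
    (φ.contDiff_normed (n := 1)).differentiable one_ne_zero _
  have h2 : HasFDerivAt (fun y : (Fin N → ℝ) × ℝ => z - y)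
      (-ContinuousLinearMap.id ℝ ((Fin N → ℝ) × ℝ)) y := (hasFDerivAt_id y).const_sub z
  have h3 := (h1.hasFDerivAt.comp y h2).fderiv
  change fderiv ℝ (reflectedBump φ z) y = _ at h3
  rw [h3]
  simp

variable {φ z} {Q : Set ((Fin N → ℝ) × ℝ)}

/-- When the support of the bump around `z` stays in `Q`, cutting off outside `Q` is invisible at
`z`, and mollifying is pairing with a test function. -/
theorem mollify_indicator_eq (hQ : Metric.closedBall z φ.rOut ⊆ Q)
    (f : (Fin N → ℝ) × ℝ → ℝ) :
    mollify volume φ (Q.indicator f) z = ∫ y, f y * reflectedBump φ z y := by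
  rw [mollify_apply]
  congr 1
  ext y
  by_cases hy : y ∈ Q
  · rw [indicator_of_mem hy, reflectedBump, mul_comm]
  · have : φ.normed volume (z - y) = 0 := by
      by_contra h
      exact hy (hQ (tsupport_reflectedBump φ z (subset_tsupport _ h)))
    rw [indicator_of_notMem hy, reflectedBump, this, mul_zero, mul_zero]

theorem fderiv_normed_mul_indicator (hQ : Metric.closedBall z φ.rOut ⊆ Q)
    (f : (Fin N → ℝ) × ℝ → ℝ) (y e : (Fin N → ℝ) × ℝ) :
    fderiv ℝ (φ.normed volume) (z - y) e * Q.indicator f y =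
      -(f y * fderiv ℝ (reflectedBump φ z) y e) := by
  rw [fderiv_reflectedBump]
  by_cases hy : y ∈ Q
  · rw [indicator_of_mem hy]
    ring
  · have h1 : fderiv ℝ (reflectedBump φ z) y = 0 := by
      by_contra h
      exact hy (hQ (tsupport_reflectedBump φ z
        (support_fderiv_subset ℝ (Function.mem_support.2 h))))
    have h2 := fderiv_reflectedBump φ z y e
    rw [h1] at h2
    have h3 : fderiv ℝ (φ.normed volume) (z - y) e = 0 := by
      simpa using h2.symm
    rw [h3]
    simp

theorem fderiv_mollify_indicator_eq (hQ : Metric.closedBall z φ.rOut ⊆ Q)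
    {f : (Fin N → ℝ) × ℝ → ℝ} (hf : Integrable (Q.indicator f)) (e : (Fin N → ℝ) × ℝ) :
    fderiv ℝ (mollify volume φ (Q.indicator f)) z e =
      -∫ y, f y * fderiv ℝ (reflectedBump φ z) y e := by
  rw [fderiv_mollify φ hf, ← integral_neg]
  congr 1
  ext y
  exact fderiv_normed_mul_indicator hQ f y e

end Reflection

namespace IsDistributionalSuperSolution

variable {N : ℕ} {p : Fin N → ℝ} {v : (Fin N → ℝ) × ℝ → ℝ} {g : Fin N → (Fin N → ℝ) × ℝ → ℝ}
  (h : IsDistributionalSuperSolution p v g)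
include h

theorem integrableOn_flux (hp : ∀ i, 2 ≤ p i) (i : Fin N) {r : ℝ} (hr : r < 1) :
    IntegrableOn (fun z => flux (p i) (g i z)) (Metric.closedBall 0 r) := by
  have : IsFiniteMeasure (volume.restrict (Metric.closedBall (0 : (Fin N → ℝ) × ℝ) r)) :=
    ⟨by simpa using measure_closedBall_lt_top⟩
  exact integrable_flux (hp i) (h.integrableOn_deriv i r hr).aestronglyMeasurable
    (h.integrableOn_rpow i r hr)

variable {φ : ContDiffBump (0 : (Fin N → ℝ) × ℝ)} {z : (Fin N → ℝ) × ℝ}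
  {Q : Set ((Fin N → ℝ) × ℝ)} {r : ℝ}

theorem fderiv_mollify_space (hr : r < 1) (hQm : MeasurableSet Q)
    (hQr : Q ⊆ Metric.closedBall 0 r) (hQ : Metric.closedBall z φ.rOut ⊆ Q) (i : Fin N) :
    fderiv ℝ (mollify volume φ (Q.indicator v)) z (Pi.single i 1, 0) =
      mollify volume φ (Q.indicator (g i)) z := by
  have hv : Integrable (Q.indicator v) :=
    (integrable_indicator_iff hQm).2 ((h.integrableOn r hr).mono_set hQr)
  rw [fderiv_mollify_indicator_eq hQ hv, mollify_indicator_eq hQ,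
    h.integral_deriv i _ (contDiff_reflectedBump φ z) (hasCompactSupport_reflectedBump φ z), neg_neg]
  exact (tsupport_reflectedBump φ z).trans
    ((hQ.trans hQr).trans (Metric.closedBall_subset_ball hr))

/-- The distributional inequality tested with the bump reflected at `z`. The reflection changes the
sign of each derivative, so the result is the pointwise inequality for the mollifications. -/
theorem sum_fderiv_mollify_le (hp : ∀ i, 2 ≤ p i) (hr : r < 1) (hQm : MeasurableSet Q)
    (hQr : Q ⊆ Metric.closedBall 0 r) (hQ : Metric.closedBall z φ.rOut ⊆ Q) :
    ∑ i, fderiv ℝ (mollify volume φ (Q.indicator fun z => flux (p i) (g i z))) z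
        (Pi.single i 1, 0) ≤
      fderiv ℝ (mollify volume φ (Q.indicator v)) z (0, 1) := by
  have hv : Integrable (Q.indicator v) :=
    (integrable_indicator_iff hQm).2 ((h.integrableOn r hr).mono_set hQr)
  have ha : ∀ i, Integrable (Q.indicator fun z => flux (p i) (g i z)) := fun i =>
    (integrable_indicator_iff hQm).2 ((h.integrableOn_flux hp i hr).mono_set hQr)
  have hsub : tsupport (reflectedBump φ z) ⊆ Metric.ball 0 1 :=
    (tsupport_reflectedBump φ z).trans
      ((hQ.trans hQr).trans (Metric.closedBall_subset_ball hr))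
  have key := h.integral_nonneg _ (contDiff_reflectedBump φ z)
    (hasCompactSupport_reflectedBump φ z) hsub fun y => φ.nonneg_normed _
  have hφ : ∀ e, Continuous fun y => fderiv ℝ (φ.normed volume) y e := fun e =>
    ((φ.contDiff_normed (n := 1)).continuous_fderiv one_ne_zero).clm_apply continuous_const
  have hφs : ∀ e, HasCompactSupport fun y => fderiv ℝ (φ.normed volume) y e := fun e =>
    φ.hasCompactSupport_normed.fderiv_apply ℝ e
  have hi : ∀ (f : (Fin N → ℝ) × ℝ → ℝ), Integrable (Q.indicator f) → ∀ e,
      Integrable fun y => f y * fderiv ℝ (reflectedBump φ z) y e := by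
    intro f hf e
    have := (integrable_comp_sub_mul (hφ e) (hφs e) hf z).neg
    refine this.congr (Eventually.of_forall fun y => ?_)
    change -(fderiv ℝ (φ.normed volume) (z - y) e * Q.indicator f y) = _
    rw [fderiv_normed_mul_indicator hQ, neg_neg]
  have hneg : Integrable fun y => -(v y * fderiv ℝ (reflectedBump φ z) y (0, 1)) :=
    (hi v hv _).neg
  rw [integral_add hneg (integrable_finsetSum _ fun i _ => hi _ (ha i) _),
    integral_finsetSum _ fun i _ => hi _ (ha i) _, integral_neg] at key
  rw [fderiv_mollify_indicator_eq hQ hv]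
  simp only [fun i => fderiv_mollify_indicator_eq hQ (ha i) (Pi.single i 1, 0)]
  rw [Finset.sum_neg_distrib]
  linarith

end IsDistributionalSuperSolution

/-! ### One iteration step for super-solutions, by passage to the limit. -/

/-- The measure of sublevel sets below a barrier passes to the limit from above. -/
theorem tendsto_lintegral_indicator_crossing {α : Type*} [MeasurableSpace α] {μ : Measure α}
    [IsFiniteMeasure μ] {u k : α → ℝ} {w : ℕ → α → ℝ} (hu : AEMeasurable u μ)
    (hk : AEMeasurable k μ) (hw : ∀ j, AEMeasurable (w j) μ)
    (hlim : ∀ᵐ z ∂μ, Tendsto (fun j => w j z) atTop (𝓝 (u z))) :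
    Tendsto (fun j => ∫⁻ z, {z | k z < u z ∧ w j z < k z}.indicator (fun _ => (1 : ℝ≥0∞)) z ∂μ)
      atTop (𝓝 0) := by
  have := tendsto_lintegral_of_dominated_convergence' (μ := μ)
    (F := fun j z => {z | k z < u z ∧ w j z < k z}.indicator (fun _ => (1 : ℝ≥0∞)) z)
    (f := fun _ => 0) (fun _ => 1)
    (fun j => aemeasurable_const.indicator₀
      ((nullMeasurableSet_lt hk hu).inter (nullMeasurableSet_lt (hw j) hk)))
    (fun j => Eventually.of_forall fun z => indicator_le_self' (fun _ _ => zero_le_one) z)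
    (by simp) ?_
  · simpa using this
  · filter_upwards [hlim] with z hz
    rcases le_or_gt (u z) (k z) with hle | hlt
    · refine tendsto_const_nhds.congr fun j => ?_
      rw [indicator_of_notMem]
      exact fun hmem => absurd hmem.1 (not_lt.2 hle)
    · refine tendsto_const_nhds.congr' ?_
      filter_upwards [hz.eventually_const_lt hlt] with j hj
      rw [indicator_of_notMem]
      exact fun hmem => absurd hmem.2 (not_lt.2 hj.le)

/-- The admissible barriers. -/
structure IsBarrier {N : ℕ} (L M : ℝ) (ψ : (Fin N → ℝ) × ℝ → ℝ) : Prop where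
  contDiff : ContDiff ℝ 1 ψ
  hasCompactSupport : HasCompactSupport ψ
  tsupport_subset : tsupport ψ ⊆ Metric.ball 0 1
  le : ∀ z, ψ z ≤ M
  fderiv_le : ∀ z, ‖fderiv ℝ ψ z‖ ≤ L

theorem IsBarrier.exists_closedBall {N : ℕ} {L M : ℝ} {ψ : (Fin N → ℝ) × ℝ → ℝ}
    (hψ : IsBarrier L M ψ) : ∃ r < 1, tsupport ψ ⊆ Metric.closedBall 0 r := by
  rcases (tsupport ψ).eq_empty_or_nonempty with he | hne
  · exact ⟨0, one_pos, by simp [he]⟩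
  · obtain ⟨z, hz, hmax⟩ := hψ.hasCompactSupport.isCompact.exists_isMaxOn hne
      continuous_norm.continuousOn
    refine ⟨‖z‖, by simpa using hψ.tsupport_subset hz, fun y hy => ?_⟩
    simpa using hmax hy

variable {N : ℕ} {p : Fin N → ℝ} {v : (Fin N → ℝ) × ℝ → ℝ} {g : Fin N → (Fin N → ℝ) × ℝ → ℝ}

theorem tendsto_iteration_bound {K c : ℝ≥0∞} (hK : K ≠ ⊤) (hc : c ≠ ⊤) {s : ℝ} (hs : 0 ≤ s)
    {x : ℕ → ℝ≥0∞} (hx : Tendsto x atTop (𝓝 c)) :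
    Tendsto (fun j => K * x j * (3 * x j) ^ s) atTop (𝓝 (K * c * (3 * c) ^ s)) := by
  refine ENNReal.Tendsto.mul (ENNReal.Tendsto.const_mul hx (Or.inr hK)) (Or.inr ?_) ?_ (Or.inr ?_)
  · exact ENNReal.rpow_ne_top_of_nonneg hs (ENNReal.mul_ne_top (by simp) hc)
  · exact (ENNReal.continuous_rpow_const.tendsto _).comp
      (ENNReal.Tendsto.const_mul hx (Or.inr (by simp)))
  · exact ENNReal.mul_ne_top hK hc

/-- One step of the iteration for super-solutions, up to the time `T < 0`. -/
theorem IsDistributionalSuperSolution.lintegral_truncation_le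
    (h : IsDistributionalSuperSolution p v g)
    (hpos : ∀ᵐ z, z ∈ Metric.ball (0 : (Fin N → ℝ) × ℝ) 1 → z.2 ≤ 0 → 0 ≤ v z)
    (hN : 1 < N) (hp : ∀ i, 2 ≤ p i) {L M T ℓ : ℝ} (hL : 1 ≤ L) (hM : 0 < M) (hT : T < 0)
    (hℓ : 0 ≤ ℓ) {ψ : (Fin N → ℝ) × ℝ → ℝ} (hψ : IsBarrier L M ψ) :
    ∫⁻ z in tsupport ψ ∩ {z | z.2 ≤ T},
        ENNReal.ofReal (truncation ψ v ℓ z ^ (2 + 3 / (N : ℝ))) ≤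
      ENNReal.ofReal (2 * N * (L + 1) / M + 2) *
        (ENNReal.ofReal (M ^ 2 * L + ∑ i, M * (2 * L) ^ p i) *
          volume (tsupport ψ ∩ {z | z.2 ≤ T} ∩ {z | v z ≤ ψ z - ℓ})) *
        (3 * (ENNReal.ofReal (M ^ 2 * L + ∑ i, M * (2 * L) ^ p i) *
          volume (tsupport ψ ∩ {z | z.2 ≤ T} ∩ {z | v z ≤ ψ z - ℓ}))) ^ (1 / (N : ℝ)) := by
  set S : Set ((Fin N → ℝ) × ℝ) := tsupport ψ ∩ {z | z.2 ≤ T} with hS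
  set C₀ : ℝ := M ^ 2 * L + ∑ i, M * (2 * L) ^ p i with hC₀
  have hC₀0 : 0 ≤ C₀ := by positivity
  have hSm : MeasurableSet S :=
    (isClosed_tsupport ψ).measurableSet.inter (measurableSet_le measurable_snd measurable_const)
  have hSfin : volume S ≠ ⊤ := ne_top_of_le_ne_top hψ.hasCompactSupport.isCompact.measure_lt_top.ne
    (measure_mono inter_subset_left)
  have : IsFiniteMeasure (volume.restrict S) := ⟨by simpa using hSfin.lt_top⟩
  obtain ⟨r, hr, hψr⟩ := hψ.exists_closedBall
  obtain ⟨r', hrr', hr'⟩ := exists_between hr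
  -- Cutting at time `0` keeps only times where positivity is known, so the mollifications are
  -- nonnegative everywhere. The gaps `r < r'` and `T < 0` leave room for small bumps centred in
  -- `S`.
  set Q : Set ((Fin N → ℝ) × ℝ) := Metric.closedBall 0 r' ∩ {z | z.2 ≤ 0} with hQ
  have hQm : MeasurableSet Q := Metric.isClosed_closedBall.measurableSet.inter
    (measurableSet_le measurable_snd measurable_const)
  have hQr : Q ⊆ Metric.closedBall 0 r' := inter_subset_left
  have hSQ : S ⊆ Q := fun z hz =>
    ⟨Metric.closedBall_subset_closedBall hrr'.le (hψr hz.1), le_trans hz.2 hT.le⟩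
  set U := Q.indicator v with hU
  have hUi : Integrable U := (integrable_indicator_iff hQm).2 ((h.integrableOn r' hr').mono_set hQr)
  have hgi : ∀ i, Integrable (Q.indicator (g i)) := fun i =>
    (integrable_indicator_iff hQm).2 ((h.integrableOn_deriv i r' hr').mono_set hQr)
  have hind : ∀ i, (fun z => flux (p i) (Q.indicator (g i) z)) =
      Q.indicator fun z => flux (p i) (g i z) := fun i =>
    indicator_comp_of_zero (g := flux (p i)) (flux_zero _) |>.symm
  have hai : ∀ i, Integrable (fun z => flux (p i) (Q.indicator (g i) z)) := fun i => by
    rw [hind]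
    exact (integrable_indicator_iff hQm).2 ((h.integrableOn_flux hp i hr').mono_set hQr)
  have hgp : ∀ i, Integrable (fun z => |Q.indicator (g i) z| ^ p i) := fun i => by
    have : (fun z => |Q.indicator (g i) z| ^ p i) = Q.indicator fun z => |g i z| ^ p i :=
      indicator_comp_of_zero (g := fun s : ℝ => |s| ^ p i)
        (by simp [Real.zero_rpow (by linarith [hp i] : p i ≠ 0)]) |>.symm
    rw [this]
    exact (integrable_indicator_iff hQm).2 ((h.integrableOn_rpow i r' hr').mono_set hQr)
  have hU0 : ∀ᵐ z, 0 ≤ U z := by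
    filter_upwards [hpos] with z hz
    by_cases hzQ : z ∈ Q
    · rw [hU, indicator_of_mem hzQ]
      exact hz (Metric.closedBall_subset_ball hr' hzQ.1) hzQ.2
    · rw [hU, indicator_of_notMem hzQ]
  set φ := shrinkingBump ((Fin N → ℝ) × ℝ) with hφ
  set w := fun j => mollify volume (φ j) U with hw
  set G := fun j i => mollify volume (φ j) (Q.indicator (g i)) with hG
  set A := fun j i => mollify volume (φ j) (fun z => flux (p i) (Q.indicator (g i) z)) with hA
  have hball : ∀ᶠ j in atTop, ∀ z ∈ S, Metric.closedBall z (φ j).rOut ⊆ Q := by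
    have h1 := (tendsto_shrinkingBump_rOut (G := (Fin N → ℝ) × ℝ)).eventually_lt_const
      (lt_min (sub_pos.2 hrr') (neg_pos.2 hT))
    filter_upwards [h1] with j hj z hz y hy
    have h2 := lt_min_iff.1 hj
    have h3 : ‖y - z‖ ≤ (φ j).rOut := by rw [← dist_eq_norm]; exact hy
    have h4 : ‖z‖ ≤ r := by simpa using hψr hz.1
    refine ⟨?_, ?_⟩
    · have : ‖y‖ ≤ ‖z‖ + ‖y - z‖ := by
        have := norm_add_le z (y - z)
        simpa using this
      have h5 : ‖y‖ ≤ r' := by linarith [h2.1]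
      simpa using h5
    · have h5 : |y.2 - z.2| ≤ ‖y - z‖ := norm_snd_le (y - z)
      have h6 := le_abs_self (y.2 - z.2)
      have h7 : z.2 ≤ T := hz.2
      change y.2 ≤ 0
      linarith [h2.2]
  have hdata : ∀ᶠ j in atTop, SmoothData L M T ψ (w j) (A j) := by
    filter_upwards [hball] with j hj
    refine ⟨hψ.contDiff, hψ.hasCompactSupport, hψ.le, hψ.fderiv_le, contDiff_mollify _ hUi,
      mollify_nonneg _ hU0, fun i => contDiff_mollify _ (hai i), fun z hz hzT => ?_⟩
    simp only [hA, hind]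
    exact h.sum_fderiv_mollify_le hp hr' hQm hQr (hj z ⟨hz, hzT⟩)
  have hgrad : ∀ᶠ j in atTop, ∀ z ∈ S, ∀ i, fderiv ℝ (w j) z (Pi.single i 1, 0) = G j i z := by
    filter_upwards [hball] with j hj z hz i
    exact h.fderiv_mollify_space hr' hQm hQr (hj z hz) i
  set e : ℕ → Fin N → (Fin N → ℝ) × ℝ → ℝ := fun j i z =>
    |A j i z - flux (p i) (G j i z)| * (1 + |G j i z|) with he
  set Y : ℝ≥0∞ := volume (S ∩ {z | v z ≤ ψ z - ℓ}) with hY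
  have hUS : ∀ z ∈ S, U z = v z := fun z hz => indicator_of_mem (hSQ hz) _
  have hYeq : ∫⁻ z in S, {z | U z ≤ ψ z - ℓ}.indicator (fun _ => (1 : ℝ≥0∞)) z = Y := by
    have hnull : NullMeasurableSet {z | U z ≤ ψ z - ℓ} (volume.restrict S) :=
      nullMeasurableSet_le hUi.aemeasurable.restrict
        (hψ.contDiff.continuous.sub continuous_const).aemeasurable
    rw [lintegral_indicator_const₀ hnull, one_mul, Measure.restrict_apply' hSm, inter_comm]
    congr 1
    ext z
    constructor
    · rintro ⟨hz, hz'⟩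
      exact ⟨hz, by simpa [hUS z hz] using hz'⟩
    · rintro ⟨hz, hz'⟩
      exact ⟨hz, by simpa [hUS z hz] using hz'⟩
  -- Points below the barrier for the mollification but not for the limit. Together with `{U ≤ ψ -
  -- ℓ}` they cover the sublevel set of the mollification, which is why the limit bound has a
  -- non-strict inequality.
  set bad : ℕ → ℝ≥0∞ := fun j => ∫⁻ z in S,
    {z | ψ z - ℓ < U z ∧ w j z < ψ z - ℓ}.indicator (fun _ => (1 : ℝ≥0∞)) z with hbad
  set err : ℕ → Fin N → ℝ≥0∞ := fun j i => ∫⁻ z in S, ENNReal.ofReal (e j i z) with herr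
  set x : ℕ → ℝ≥0∞ := fun j => ENNReal.ofReal C₀ * (Y + bad j) +
    ∑ i, ENNReal.ofReal (2 * M * (L + 1)) * err j i with hx
  have hconv : ∀ᵐ z, Tendsto (fun j => w j z) atTop (𝓝 (U z)) := ae_tendsto_mollify hUi
  have cw : ∀ j, Continuous (w j) := fun j => (contDiff_mollify _ hUi).continuous
  have cψ : Continuous fun z => ψ z - ℓ := hψ.contDiff.continuous.sub continuous_const
  have hx_lim : Tendsto x atTop (𝓝 (ENNReal.ofReal C₀ * Y)) := by
    have h1 : Tendsto bad atTop (𝓝 0) := tendsto_lintegral_indicator_crossing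
      hUi.aemeasurable.restrict cψ.aemeasurable (fun j => (cw j).aemeasurable)
      (ae_restrict_of_ae hconv)
    have h2 : ∀ i, Tendsto (fun j => err j i) atTop (𝓝 0) := fun i =>
      tendsto_lintegral_flux_commutator (hp i) (hgi i) (hgp i) (hai i) hSfin
    have h3 := ENNReal.Tendsto.const_mul (a := ENNReal.ofReal C₀) (h1.const_add Y)
      (Or.inr ENNReal.ofReal_ne_top)
    have h4 : Tendsto (fun j => ∑ i, ENNReal.ofReal (2 * M * (L + 1)) * err j i) atTop
        (𝓝 (∑ _i : Fin N, ENNReal.ofReal (2 * M * (L + 1)) * 0)) :=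
      tendsto_finsetSum _ fun i _ => ENNReal.Tendsto.const_mul (h2 i)
        (Or.inr ENNReal.ofReal_ne_top)
    simpa using h3.add h4
  have cG : ∀ j i, Continuous (G j i) := fun j i => (contDiff_mollify _ (hgi i)).continuous
  have cA : ∀ j i, Continuous (A j i) := fun j i => (contDiff_mollify _ (hai i)).continuous
  have ce : ∀ j i, Continuous (e j i) := fun j i => by
    have h1 := (continuous_flux (hp i)).comp (cG j i)
    have h2 := cG j i
    have h3 := cA j i
    simp only [Function.comp_def] at h1
    simp only [he]
    fun_prop
  have henergy : ∀ᶠ j in atTop,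
      ∫⁻ z, ENNReal.ofReal (energyDensity p L M ℓ ψ (w j) (A j) z) ∂volumeUpTo N T ≤ x j := by
    filter_upwards [hgrad] with j hj
    have hw0 : ∀ z, 0 ≤ w j z := mollify_nonneg _ hU0
    have hpt : ∀ z, z.2 ≤ T → ENNReal.ofReal (energyDensity p L M ℓ ψ (w j) (A j) z) ≤
        (tsupport ψ).indicator (fun z => ENNReal.ofReal C₀ *
          ({z | U z ≤ ψ z - ℓ}.indicator (fun _ => (1 : ℝ≥0∞)) z +
            {z | ψ z - ℓ < U z ∧ w j z < ψ z - ℓ}.indicator (fun _ => (1 : ℝ≥0∞)) z) +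
          ∑ i, ENNReal.ofReal (2 * M * (L + 1)) * ENNReal.ofReal (e j i z)) z := by
      intro z hzT
      by_cases hz : z ∈ tsupport ψ
      · rw [indicator_of_mem hz, energyDensity, indicator_of_mem hz]
        refine ENNReal.ofReal_add_le.trans (add_le_add ?_ ?_)
        · by_cases hlt : w j z < ψ z - ℓ
          · rw [indicator_of_mem (show z ∈ {z | w j z < ψ z - ℓ} from hlt)]
            rcases le_or_gt (U z) (ψ z - ℓ) with hle | hgt
            · rw [indicator_of_mem (show z ∈ {z | U z ≤ ψ z - ℓ} from hle), mul_add, mul_one]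
              exact le_self_add
            · rw [indicator_of_mem
                (show z ∈ {z | ψ z - ℓ < U z ∧ w j z < ψ z - ℓ} from ⟨hgt, hlt⟩), mul_add, mul_one]
              exact le_add_self
          · rw [indicator_of_notMem (show z ∉ {z | w j z < ψ z - ℓ} from hlt)]
            simp
        · rw [Finset.mul_sum, ENNReal.ofReal_sum_of_nonneg fun i _ => by positivity]
          refine Finset.sum_le_sum fun i _ => ?_
          rw [ENNReal.ofReal_mul (by positivity), hj z ⟨hz, hzT⟩ i]
      · have h1 := image_eq_zero_of_notMem_tsupport hz
        have h2 : z ∉ {z | w j z < ψ z - ℓ} := fun hmem => by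
          have : w j z < ψ z - ℓ := hmem
          linarith [hw0 z]
        rw [energyDensity, indicator_of_notMem h2, indicator_of_notMem hz]
        simp
    rw [volumeUpTo_eq]
    refine (setLIntegral_mono_ae' (measurableSet_le measurable_snd measurable_const)
      (Eventually.of_forall fun z hz => hpt z hz)).trans ?_
    rw [lintegral_indicator (isClosed_tsupport ψ).measurableSet,
      Measure.restrict_restrict (isClosed_tsupport ψ).measurableSet, ← hS]
    have hme : ∀ i, Measurable fun z =>
        ENNReal.ofReal (2 * M * (L + 1)) * ENNReal.ofReal (e j i z) := fun i =>
      ((ce j i).measurable.ennreal_ofReal).const_mul _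
    have hm1 : AEMeasurable (fun z => {z | U z ≤ ψ z - ℓ}.indicator (fun _ => (1 : ℝ≥0∞)) z)
        (volume.restrict S) :=
      aemeasurable_const.indicator₀
        (nullMeasurableSet_le hUi.aemeasurable.restrict cψ.aemeasurable)
    rw [lintegral_add_right _ (Finset.measurable_sum _ fun i _ => hme i),
      lintegral_const_mul' _ _ ENNReal.ofReal_ne_top, lintegral_add_left' hm1, hYeq,
      lintegral_finsetSum _ fun i _ => hme i]
    refine add_le_add le_rfl (Finset.sum_le_sum fun i _ => le_of_eq ?_)
    rw [lintegral_const_mul' _ _ ENNReal.ofReal_ne_top]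
  set K : ℝ≥0∞ := ENNReal.ofReal (2 * N * (L + 1) / M + 2) with hK
  have hstep : ∀ᶠ j in atTop,
      ∫⁻ z in S, ENNReal.ofReal (truncation ψ (w j) ℓ z ^ (2 + 3 / (N : ℝ))) ≤
        K * x j * (3 * x j) ^ (1 / (N : ℝ)) := by
    filter_upwards [hdata, henergy] with j hj hjx
    have h1 : ∫⁻ z in S, ENNReal.ofReal (truncation ψ (w j) ℓ z ^ (2 + 3 / (N : ℝ))) ≤
        ∫⁻ z, ENNReal.ofReal (truncation ψ (w j) ℓ z ^ (2 + 3 / (N : ℝ))) ∂volumeUpTo N T := by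
      rw [volumeUpTo_eq]
      exact lintegral_mono_set inter_subset_right
    refine h1.trans ((hj.lintegral_truncation_le hN hL hM hℓ hp).trans ?_)
    gcongr
  have hYfin : Y ≠ ⊤ := ne_top_of_le_ne_top hSfin (measure_mono inter_subset_left)
  have hlim := tendsto_iteration_bound (K := K) ENNReal.ofReal_ne_top
    (ENNReal.mul_ne_top ENNReal.ofReal_ne_top hYfin)
    (by positivity : (0 : ℝ) ≤ 1 / (N : ℝ)) hx_lim
  have ctr : ∀ j, Continuous (truncation ψ (w j) ℓ) := fun j => by
    have := cw j
    unfold truncation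
    fun_prop
  have hexp : (0 : ℝ) ≤ 2 + 3 / (N : ℝ) := by positivity
  -- Fatou's lemma on the left; on the right the bounds converge.
  calc ∫⁻ z in S, ENNReal.ofReal (truncation ψ v ℓ z ^ (2 + 3 / (N : ℝ)))
      ≤ ∫⁻ z in S, liminf (fun j =>
          ENNReal.ofReal (truncation ψ (w j) ℓ z ^ (2 + 3 / (N : ℝ)))) atTop := by
        refine lintegral_mono_ae ?_
        filter_upwards [ae_restrict_of_ae hconv, ae_restrict_mem hSm] with z hz hzS
        rw [hUS z hzS] at hz
        have h1 : Tendsto (fun j => truncation ψ (w j) ℓ z) atTop (𝓝 (truncation ψ v ℓ z)) :=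
          (hz.const_sub (ψ z - ℓ)).max tendsto_const_nhds
        have h2 := ENNReal.tendsto_ofReal
          (((Real.continuous_rpow_const hexp).tendsto _).comp h1)
        exact h2.liminf_eq.ge
    _ ≤ liminf (fun j => ∫⁻ z in S,
          ENNReal.ofReal (truncation ψ (w j) ℓ z ^ (2 + 3 / (N : ℝ)))) atTop :=
        lintegral_liminf_le' fun j =>
          (((ctr j).rpow_const fun _ => Or.inr hexp).measurable.ennreal_ofReal).aemeasurable
    _ ≤ liminf (fun j => K * x j * (3 * x j) ^ (1 / (N : ℝ))) atTop :=
        liminf_le_liminf hstep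
    _ = _ := hlim.liminf_eq

/-! ### The barrier, the De Giorgi iteration and the critical mass lemma. -/

theorem exists_smooth_barrier {N : ℕ} {C O : Set ((Fin N → ℝ) × ℝ)} (hC : IsCompact C)
    (hO : IsOpen O) (hCO : C ⊆ O) (hOb : O ⊆ Metric.ball 0 1) {M : ℝ} (hM : 0 < M) :
    ∃ (ψ : (Fin N → ℝ) × ℝ → ℝ) (L : ℝ), 1 ≤ L ∧ IsBarrier L M ψ ∧ tsupport ψ ⊆ O ∧
      ∀ z ∈ C, ψ z = M := by
  obtain ⟨K, hK, hCK, hKO⟩ := exists_compact_between hC hO hCO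
  obtain ⟨χ, hχ, hrange, hsupp, hone⟩ := exists_contMDiff_support_eq_eq_one_iff
    (modelWithCornersSelf ℝ ((Fin N → ℝ) × ℝ)) (n := 1)
    isOpen_interior hC.isClosed hCK
  have hχ' : ContDiff ℝ 1 χ := hχ.contDiff
  have hts : tsupport χ ⊆ K := closure_minimal (hsupp.le.trans interior_subset) hK.isClosed
  have hcs : HasCompactSupport χ := hK.of_isClosed_subset (isClosed_tsupport χ) hts
  set ψ : (Fin N → ℝ) × ℝ → ℝ := fun z => M * χ z with hψ
  have hψ1 : ContDiff ℝ 1 ψ := contDiff_const.mul hχ'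
  have hψt : tsupport ψ ⊆ tsupport χ := closure_mono (Function.support_mul_subset_right (fun _ => M) χ)
  have hψc : HasCompactSupport ψ := hcs.mul_left
  obtain ⟨L, hL⟩ := (hψc.fderiv ℝ).exists_bound_of_continuous (hψ1.continuous_fderiv one_ne_zero)
  have hψO : tsupport ψ ⊆ O := hψt.trans (hts.trans hKO)
  refine ⟨ψ, max L 1, le_max_right _ _, ⟨hψ1, hψc, hψO.trans hOb, fun z => ?_,
    fun z => (hL z).trans (le_max_left _ _)⟩, hψO, fun z hz => ?_⟩
  · have : χ z ≤ 1 := (hrange ⟨z, rfl⟩).2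
    exact mul_le_of_le_one_right hM.le this
  · simp only [hψ, (hone z).1 hz, mul_one]

variable {N : ℕ} {p : Fin N → ℝ}

/-- The iteration up to a negative time, with a threshold independent of that time. -/
theorem exists_threshold_upTo (hN : 1 < N) (hp : ∀ i, 2 ≤ p i) {L m M : ℝ} (hL : 1 ≤ L)
    (hmM : m < M) (hM : 0 < M) {ψ : (Fin N → ℝ) × ℝ → ℝ} (hψ : IsBarrier L M ψ) :
    ∃ ν : ℝ, 0 < ν ∧ ∀ v g, IsDistributionalSuperSolution p v g →
      (∀ᵐ z, z ∈ Metric.ball (0 : (Fin N → ℝ) × ℝ) 1 → z.2 ≤ 0 → 0 ≤ v z) → ∀ T < 0,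
      volume (tsupport ψ ∩ {z | z.2 ≤ T} ∩ {z | v z ≤ ψ z}) ≤ ENNReal.ofReal ν →
      volume (tsupport ψ ∩ {z | z.2 ≤ T} ∩ {z | v z ≤ ψ z - (M - m)}) = 0 := by
  have hN0 : (0 : ℝ) < N := by positivity
  set q : ℝ := 2 + 3 / (N : ℝ) with hq
  have hq0 : 0 < q := by positivity
  set C₀ : ℝ := M ^ 2 * L + ∑ i, M * (2 * L) ^ p i with hC₀
  have hC₀0 : 0 < C₀ := by positivity
  set K : ℝ := 2 * N * (L + 1) / M + 2 with hK
  have hK0 : 0 < K := by positivity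
  set d : ℝ := (M - m) / 2 with hd
  have hd0 : 0 < d := by simp only [hd]; linarith
  set b : ℝ := 2 ^ q with hb
  have hb1 : 1 < b := Real.one_lt_rpow one_lt_two hq0
  set C : ℝ := (d ^ q)⁻¹ * (K * C₀ * (3 * C₀) ^ (1 / (N : ℝ))) with hC
  have hC0 : 0 < C := by positivity
  -- The threshold of `fast_geometric_convergence`; neither `C` nor `b` involves `v` or `T`.
  refine ⟨(C * b ^ N)⁻¹ ^ N, by positivity, fun v g h hpos T hT h0 => ?_⟩
  set S : Set ((Fin N → ℝ) × ℝ) := tsupport ψ ∩ {z | z.2 ≤ T} with hS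
  have hSfin : volume S ≠ ⊤ := ne_top_of_le_ne_top hψ.hasCompactSupport.isCompact.measure_lt_top.ne
    (measure_mono inter_subset_left)
  -- Levels from `0`, where the hypothesis is stated, up to the limit `M - m`, with gaps `d 2⁻ⁿ`.
  set ℓ : ℕ → ℝ := fun n => (M - m) * (1 - (1 / 2) ^ n) with hℓ
  have hpow : ∀ n : ℕ, ((1 : ℝ) / 2) ^ n ≤ 1 := fun n => pow_le_one₀ (by norm_num) (by norm_num)
  have hℓ0 : ∀ n, 0 ≤ ℓ n := fun n => mul_nonneg (by linarith) (by linarith [hpow n])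
  have hℓd : ∀ n, ℓ (n + 1) - ℓ n = d * (1 / 2) ^ n := fun n => by
    simp only [hℓ, hd, pow_succ]
    ring
  have hℓM : ∀ n, ℓ n ≤ M - m := fun n => by
    have : (0 : ℝ) ≤ (1 / 2) ^ n := by positivity
    simp only [hℓ]
    nlinarith
  set Y : ℕ → ℝ≥0∞ := fun n => volume (S ∩ {z | v z ≤ ψ z - ℓ n}) with hY
  have hYfin : ∀ n, Y n ≠ ⊤ := fun n => ne_top_of_le_ne_top hSfin (measure_mono inter_subset_left)
  have hvS : AEMeasurable v (volume.restrict S) := by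
    obtain ⟨r, hr, hψr⟩ := hψ.exists_closedBall
    exact ((h.integrableOn r hr).mono_set (inter_subset_left.trans hψr)).aemeasurable
  have hSm : MeasurableSet S :=
    (isClosed_tsupport ψ).measurableSet.inter (measurableSet_le measurable_snd measurable_const)
  have hstep : ∀ n, (Y (n + 1)).toReal ≤ C * b ^ n * (Y n).toReal ^ (1 + 1 / (N : ℝ)) := by
    intro n
    have h1 := h.lintegral_truncation_le hpos hN hp hL hM hT (hℓ0 n) hψ
    -- Chebyshev's inequality: below level `n + 1` the truncation at level `n` is at least the gap
    -- `d 2⁻ⁿ`. Its power `q` is the source of `b = 2^q`.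
    have h2 : ENNReal.ofReal ((d * (1 / 2) ^ n) ^ q) * Y (n + 1) ≤
        ∫⁻ z in S, ENNReal.ofReal (truncation ψ v (ℓ n) z ^ q) := by
      have hmeas : AEMeasurable (fun z => ENNReal.ofReal (truncation ψ v (ℓ n) z ^ q))
          (volume.restrict S) := by
        have h3 : AEMeasurable (truncation ψ v (ℓ n)) (volume.restrict S) :=
          ((hψ.contDiff.continuous.aemeasurable.sub_const _).sub hvS).max aemeasurable_const
        exact (h3.pow_const q).ennreal_ofReal
      refine le_trans ?_
        (mul_meas_ge_le_lintegral₀ hmeas (ENNReal.ofReal ((d * (1 / 2) ^ n) ^ q)))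
      gcongr
      rw [Measure.restrict_apply' hSm, inter_comm]
      refine measure_mono (inter_subset_inter_right _ fun z hz => ?_)
      have hz' : v z ≤ ψ z - ℓ (n + 1) := hz
      refine ENNReal.ofReal_le_ofReal (Real.rpow_le_rpow (by positivity) ?_ hq0.le)
      refine le_trans ?_ (le_max_left _ _)
      linarith [hℓd n]
    have h4 := h2.trans h1
    have hr1 : (3 * (ENNReal.ofReal C₀ * Y n)) ^ (1 / (N : ℝ)) =
        ENNReal.ofReal ((3 * (C₀ * (Y n).toReal)) ^ (1 / (N : ℝ))) := by
      rw [← ENNReal.ofReal_rpow_of_nonneg (by positivity) (by positivity),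
        ENNReal.ofReal_mul (by norm_num), ENNReal.ofReal_mul hC₀0.le,
        ENNReal.ofReal_toReal (hYfin n), ENNReal.ofReal_ofNat]
    have hr2 : ENNReal.ofReal K * (ENNReal.ofReal C₀ * Y n) =
        ENNReal.ofReal (K * (C₀ * (Y n).toReal)) := by
      rw [ENNReal.ofReal_mul hK0.le, ENNReal.ofReal_mul hC₀0.le, ENNReal.ofReal_toReal (hYfin n)]
    have hr3 : ENNReal.ofReal ((d * (1 / 2) ^ n) ^ q) * Y (n + 1) =
        ENNReal.ofReal ((d * (1 / 2) ^ n) ^ q * (Y (n + 1)).toReal) := by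
      rw [ENNReal.ofReal_mul (by positivity), ENNReal.ofReal_toReal (hYfin (n + 1))]
    have h5 : ENNReal.ofReal ((d * (1 / 2) ^ n) ^ q * (Y (n + 1)).toReal) ≤
        ENNReal.ofReal (K * (C₀ * (Y n).toReal) * (3 * (C₀ * (Y n).toReal)) ^ (1 / (N : ℝ))) := by
      rw [← hr3, ENNReal.ofReal_mul (p := K * (C₀ * (Y n).toReal)) (by positivity), ← hr1, ← hr2]
      exact h4
    have h6 := (ENNReal.ofReal_le_ofReal_iff (by positivity)).1 h5
    have hy0 : 0 ≤ (Y n).toReal := ENNReal.toReal_nonneg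
    have h7 : (d * (1 / 2) ^ n) ^ q = d ^ q * (b ^ n)⁻¹ := by
      rw [Real.mul_rpow hd0.le (by positivity), hb, ← Real.rpow_natCast, ← Real.rpow_natCast,
        ← Real.rpow_mul (by norm_num), ← Real.rpow_mul (by norm_num), one_div,
        Real.inv_rpow (by norm_num), mul_comm q]
    rw [h7] at h6
    have hbn : 0 < b ^ n := by positivity
    have hdq : 0 < d ^ q := by positivity
    calc (Y (n + 1)).toReal
        = (d ^ q)⁻¹ * b ^ n * (d ^ q * (b ^ n)⁻¹ * (Y (n + 1)).toReal) := by field_simp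
      _ ≤ (d ^ q)⁻¹ * b ^ n *
          (K * (C₀ * (Y n).toReal) * (3 * (C₀ * (Y n).toReal)) ^ (1 / (N : ℝ))) := by gcongr
      _ = _ := by
          rw [← mul_assoc 3, Real.mul_rpow (by positivity) hy0, Real.rpow_add' hy0 (by positivity),
            Real.rpow_one, hC]
          ring
  have hlim := fast_geometric_convergence (by omega : 0 < N) hC0 hb1
    (fun n => ENNReal.toReal_nonneg) hstep ?_
  · have hle : ∀ n, (volume (S ∩ {z | v z ≤ ψ z - (M - m)})).toReal ≤ (Y n).toReal := fun n =>
      ENNReal.toReal_mono (hYfin n) (measure_mono (inter_subset_inter_right _ fun z hz => by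
        have hz' : v z ≤ ψ z - (M - m) := hz
        change v z ≤ ψ z - ℓ n
        linarith [hℓM n]))
    have h0' := ge_of_tendsto' hlim hle
    have h1 := le_antisymm h0' ENNReal.toReal_nonneg
    refine ((ENNReal.toReal_eq_zero_iff _).1 h1).resolve_right ?_
    exact ne_top_of_le_ne_top hSfin (measure_mono inter_subset_left)
  · refine ENNReal.toReal_le_of_le_ofReal (by positivity) ?_
    simpa [hY, hℓ] using h0

/-- De Giorgi's critical mass lemma for super-solutions in the sense of distributions. -/
theorem exists_critical_mass (hN : 1 < N) (hp : ∀ i, 2 ≤ p i) {C O : Set ((Fin N → ℝ) × ℝ)}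
    (hC : IsCompact C) (hO : IsOpen O) (hCO : C ⊆ O) (hOb : O ⊆ Metric.ball 0 1) {m M : ℝ}
    (hmM : m < M) (hM : 0 < M) :
    ∃ ν : ℝ, 0 < ν ∧ ∀ v g, IsDistributionalSuperSolution p v g →
      (∀ᵐ z, z ∈ Metric.ball (0 : (Fin N → ℝ) × ℝ) 1 → z.2 ≤ 0 → 0 ≤ v z) →
      volume ({z | v z ≤ M} ∩ (O ∩ {z | z.2 ≤ 0})) ≤ ENNReal.ofReal ν →
      ∀ᵐ z, z ∈ C → z.2 ≤ 0 → m ≤ v z := by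
  obtain ⟨ψ, L, hL, hψ, hψO, hψC⟩ := exists_smooth_barrier hC hO hCO hOb hM
  obtain ⟨ν, hν, hmain⟩ := exists_threshold_upTo hN hp hL hmM hM hψ
  refine ⟨ν, hν, fun v g h hpos h0 => ?_⟩
  -- The same `ν` serves all times `T = -1/(k+1)`. Their union misses only the null slice `t = 0`.
  have hneg : ∀ k : ℕ, ∀ᵐ z : (Fin N → ℝ) × ℝ, z ∈ C → z.2 ≤ -(1 / ((k : ℝ) + 1)) → m ≤ v z := by
    intro k
    have hT : -(1 / ((k : ℝ) + 1)) < 0 := neg_lt_zero.2 (by positivity)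
    have hz := hmain v g h hpos _ hT (le_trans (measure_mono ?_) h0)
    · rw [ae_iff]
      refine measure_mono_null (fun z hz => ?_) hz
      simp only [mem_ofPred_eq, Classical.not_imp, not_le] at hz
      have hψz := hψC z hz.1
      refine ⟨⟨subset_tsupport _ ?_, hz.2.1⟩, ?_⟩
      · rw [Function.mem_support, hψz]
        exact hM.ne'
      · change v z ≤ ψ z - (M - m)
        linarith [hz.2.2]
    · rintro z ⟨⟨hz1, hz2⟩, hz3⟩
      exact ⟨le_trans hz3 (hψ.le z), hψO hz1, le_trans hz2 hT.le⟩
  have hzero : ∀ᵐ z : (Fin N → ℝ) × ℝ, z.2 ≠ 0 := by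
    rw [ae_iff]
    have : {z : (Fin N → ℝ) × ℝ | ¬z.2 ≠ 0} = univ ×ˢ {0} := by
      ext z
      simp
    rw [this, Measure.volume_eq_prod, Measure.prod_prod]
    simp
  filter_upwards [ae_all_iff.2 hneg, hzero] with z hz hz0 hzC hzt
  have hlt : 0 < -z.2 := neg_pos.2 (lt_of_le_of_ne hzt hz0)
  obtain ⟨k, hk⟩ := exists_nat_one_div_lt hlt
  exact hz k hzC (by linarith)

/-! ### From local weak solutions to distributional super-solutions. -/

section FromWeakSolutions

variable {N : ℕ} {p : Fin N → ℝ} {u : (Fin N → ℝ) × ℝ → ℝ} {g : Fin N → (Fin N → ℝ) × ℝ → ℝ}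

theorem cube_one_eq_ball : cube N 1 = Metric.ball 0 1 := by
  ext x
  simp [cube, pi_norm_lt_iff]

theorem closedBall_subset_cylinder (r : ℝ) :
    Metric.closedBall (0 : (Fin N → ℝ) × ℝ) r ⊆ Metric.closedBall 0 (max r 0) ×ˢ
      Icc (-(max r 0)) (max r 0) := by
  intro z hz
  have h1 : ‖z‖ ≤ r := by simpa using hz
  have h2 : |z.2| ≤ ‖z‖ := norm_snd_le z
  refine ⟨?_, abs_le.1 (h2.trans (h1.trans (le_max_left _ _)))⟩
  rw [mem_closedBall_zero_iff]
  exact (norm_fst_le z).trans (h1.trans (le_max_left _ _))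

theorem integral_fderiv_eq_zero {φ : (Fin N → ℝ) × ℝ → ℝ} (hφ : ContDiff ℝ 1 φ)
    (hφs : HasCompactSupport φ) (e : (Fin N → ℝ) × ℝ) : ∫ z, fderiv ℝ φ z e = 0 := by
  have hc : Continuous fun z => fderiv ℝ φ z e :=
    (hφ.continuous_fderiv one_ne_zero).clm_apply continuous_const
  have h := integral_mul_fderiv_eq_neg_fderiv_mul_of_integrable (𝕜 := ℝ)
    (μ := (volume : Measure ((Fin N → ℝ) × ℝ))) (f := fun _ => (1 : ℝ)) (g := φ) (v := e)
    (by simp)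
    (by simpa using hc.integrable_of_hasCompactSupport (hφs.fderiv_apply ℝ e))
    (by simpa using hφ.continuous.integrable_of_hasCompactSupport hφs)
    (fun _ _ => differentiableAt_const _) (fun z _ => hφ.differentiable one_ne_zero z)
  simpa using h

theorem exists_closedBall_of_tsupport_subset {φ : (Fin N → ℝ) × ℝ → ℝ}
    (hφs : HasCompactSupport φ) (hφ : tsupport φ ⊆ Metric.ball 0 1) :
    ∃ r, 0 < r ∧ r < 1 ∧ tsupport φ ⊆ Metric.ball 0 r := by
  rcases (tsupport φ).eq_empty_or_nonempty with he | hne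
  · exact ⟨1 / 2, by norm_num, by norm_num, by simp [he]⟩
  · obtain ⟨z, hz, hmax⟩ := hφs.isCompact.exists_isMaxOn hne continuous_norm.continuousOn
    have h1 : ‖z‖ < 1 := by simpa using hφ hz
    obtain ⟨r, hr, hr1⟩ := exists_between h1
    refine ⟨r, (norm_nonneg z).trans_lt hr, hr1, fun y hy => ?_⟩
    have : ‖y‖ ≤ ‖z‖ := hmax hy
    simpa using this.trans_lt hr

theorem integrable_mul_of_tsupport_subset {f k : (Fin N → ℝ) × ℝ → ℝ} {r : ℝ}
    (hf : IntegrableOn f (Metric.closedBall 0 r)) (hk : Continuous k)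
    (hkr : tsupport k ⊆ Metric.closedBall 0 r) : Integrable fun z => f z * k z := by
  have h1 : IntegrableOn (fun z => f z * k z) (Metric.closedBall 0 r) :=
    hf.mul_continuousOn hk.continuousOn (isCompact_closedBall _ _)
  refine (integrableOn_iff_integrable_of_support_subset fun z hz => ?_).1 h1
  exact hkr (subset_tsupport _ (right_ne_zero_of_mul hz))

theorem tsupport_fderiv_apply_subset_tsupport (φ : (Fin N → ℝ) × ℝ → ℝ) (e : (Fin N → ℝ) × ℝ) :
    tsupport (fun z => fderiv ℝ φ z e) ⊆ tsupport φ :=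
  closure_minimal (fun z hz => support_fderiv_subset ℝ fun h0 => hz (by simp [h0]))
    (isClosed_tsupport φ)

namespace HasAnisotropicGradient

variable (h : HasAnisotropicGradient p (cube N 1) 1 u g)
include h

theorem integrableOn_closedBall {r : ℝ} (hr : r < 1) : IntegrableOn u (Metric.closedBall 0 r) := by
  have h0 : (0 : ℝ) ≤ max r 0 := le_max_right _ _
  have h1 : max r 0 < 1 := max_lt hr one_pos
  refine (h.integrableOn (Metric.closedBall 0 (max r 0)) (isCompact_closedBall _ _) ?_ _
    ⟨by linarith, by linarith⟩ _ ⟨by linarith, h1⟩).mono_set (closedBall_subset_cylinder r)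
  rw [cube_one_eq_ball]
  exact Metric.closedBall_subset_ball h1

theorem memLp_closedBall (i : Fin N) {r : ℝ} (hr : r < 1) :
    MemLp (g i) (ENNReal.ofReal (p i)) (volume.restrict (Metric.closedBall 0 r)) := by
  have h0 : (0 : ℝ) ≤ max r 0 := le_max_right _ _
  have h1 : max r 0 < 1 := max_lt hr one_pos
  refine (h.memLp i (Metric.closedBall 0 (max r 0)) (isCompact_closedBall _ _) ?_ _
    ⟨by linarith, by linarith⟩ _ ⟨by linarith, h1⟩).mono_measure
    (Measure.restrict_mono (closedBall_subset_cylinder r) le_rfl)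
  rw [cube_one_eq_ball]
  exact Metric.closedBall_subset_ball h1

theorem integrableOn_deriv_closedBall (hp : ∀ i, 2 ≤ p i) (i : Fin N) {r : ℝ} (hr : r < 1) :
    IntegrableOn (g i) (Metric.closedBall 0 r) := by
  have : IsFiniteMeasure (volume.restrict (Metric.closedBall (0 : (Fin N → ℝ) × ℝ) r)) :=
    ⟨by simpa using measure_closedBall_lt_top⟩
  refine (h.memLp_closedBall i hr).integrable ?_
  rw [ENNReal.one_le_ofReal]
  linarith [hp i]

theorem integrableOn_rpow_closedBall (hp : ∀ i, 2 ≤ p i) (i : Fin N) {r : ℝ} (hr : r < 1) :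
    IntegrableOn (fun z => |g i z| ^ p i) (Metric.closedBall 0 r) := by
  have h0 : 0 < p i := by linarith [hp i]
  have := (h.memLp_closedBall i hr).integrable_norm_rpow (by simpa using h0) ENNReal.ofReal_ne_top
  rw [ENNReal.toReal_ofReal h0.le] at this
  exact this

theorem integral_space_deriv (hp : ∀ i, 2 ≤ p i) (i : Fin N) {φ : (Fin N → ℝ) × ℝ → ℝ}
    (hφ : ContDiff ℝ ∞ φ) (hφs : HasCompactSupport φ) (hφt : tsupport φ ⊆ Metric.ball 0 1) :
    ∫ z, u z * fderiv ℝ φ z (Pi.single i 1, 0) = -∫ z, g i z * φ z := by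
  obtain ⟨r, -, hr, hφr⟩ := exists_closedBall_of_tsupport_subset hφs hφt
  have hφr' := hφr.trans Metric.ball_subset_closedBall
  have hφ1 : ContDiff ℝ 1 φ := hφ.of_le (by norm_cast)
  have hd := hφ1.differentiable one_ne_zero
  have i1 : Integrable fun z => u z * fderiv ℝ φ z (Pi.single i 1, 0) :=
    integrable_mul_of_tsupport_subset (h.integrableOn_closedBall hr)
      ((hφ1.continuous_fderiv one_ne_zero).clm_apply continuous_const)
      ((tsupport_fderiv_apply_subset_tsupport φ _).trans hφr')
  have i2 : Integrable fun z => g i z * φ z :=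
    integrable_mul_of_tsupport_subset (h.integrableOn_deriv_closedBall hp i hr)
      hφ1.continuous hφr'
  rw [Measure.volume_eq_prod] at *
  -- Fubini reduces the space-time identity to the weak derivative on almost every time slice;
  -- slices outside `(-1,1)` contribute nothing.
  rw [integral_prod_symm _ i1, integral_prod_symm _ i2, ← integral_neg]
  refine integral_congr_ae ?_
  have hae := (ae_restrict_iff' measurableSet_Ioo).1 (h.hasWeakPartial i)
  filter_upwards [hae] with t ht
  have hout : ∀ x, (x, t) ∉ Metric.ball (0 : (Fin N → ℝ) × ℝ) 1 →
      φ (x, t) = 0 ∧ fderiv ℝ φ (x, t) = 0 := fun x hx =>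
    ⟨image_eq_zero_of_notMem_tsupport fun hmem => hx (hφt hmem), by
      by_contra h0
      exact hx (hφt (support_fderiv_subset ℝ (Function.mem_support.2 h0)))⟩
  by_cases htI : t ∈ Ioo (-1 : ℝ) 1
  · have hslice : tsupport (fun x => φ (x, t)) ⊆ cube N 1 := by
      have h1 : tsupport (fun x => φ (x, t)) ⊆ {x | (x, t) ∈ tsupport φ} :=
        closure_minimal (fun x hx => subset_tsupport φ hx)
          ((isClosed_tsupport φ).preimage (by fun_prop))
      intro x hx
      rw [cube_one_eq_ball]
      have h2 : ‖(x, t)‖ < 1 := by simpa using hφt (h1 hx)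
      simpa using (norm_fst_le (x, t)).trans_lt h2
    have hw := (ht htI).integral_eq (fun x => φ (x, t)) (hφ.comp (by fun_prop))
      (hasCompactSupport_space_slice hφs t) hslice
    have hball : ∀ x, x ∉ cube N 1 → (x, t) ∉ Metric.ball (0 : (Fin N → ℝ) × ℝ) 1 := by
      intro x hx hmem
      refine hx ?_
      rw [cube_one_eq_ball]
      have h2 : ‖(x, t)‖ < 1 := by simpa using hmem
      simpa using (norm_fst_le (x, t)).trans_lt h2
    simp only [fderiv_space_slice (hd _)] at hw
    rw [setIntegral_eq_integral_of_forall_compl_eq_zero fun x hx => by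
        simp [(hout x (hball x hx)).2],
      setIntegral_eq_integral_of_forall_compl_eq_zero fun x hx => by
        simp [(hout x (hball x hx)).1]] at hw
    exact hw
  · have hball : ∀ x, (x, t) ∉ Metric.ball (0 : (Fin N → ℝ) × ℝ) 1 := by
      intro x hmem
      refine htI (abs_lt.1 ?_)
      have h2 : ‖(x, t)‖ < 1 := by simpa using hmem
      exact (norm_snd_le (x, t)).trans_lt h2
    simp [fun x => (hout x (hball x)).1, fun x => (hout x (hball x)).2]

end HasAnisotropicGradient

/-- The test function is supported in a ball of radius `r < 1`, so with `t₁ = -r` and `t₂ = r` the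
boundary terms vanish and the weak form becomes an integral over the whole space. -/
theorem exists_weakForm_eq {φ : (Fin N → ℝ) × ℝ → ℝ} (hφ : ContDiff ℝ ∞ φ)
    (hφs : HasCompactSupport φ) (hφt : tsupport φ ⊆ Metric.ball 0 1) (hφ0 : ∀ z, 0 ≤ φ z) :
    ∃ K : Set (Fin N → ℝ), IsCompact K ∧ K ⊆ cube N 1 ∧ ∃ t₁ ∈ Ioo (-1 : ℝ) 1,
      ∃ t₂ ∈ Ioo (-1 : ℝ) 1, t₁ < t₂ ∧ IsNonnegTestFunction K 1 φ ∧
      ∀ (u : (Fin N → ℝ) × ℝ → ℝ) (g : Fin N → (Fin N → ℝ) × ℝ → ℝ),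
        weakForm p K t₁ t₂ u g φ = ∫ z, (-(u z * fderiv ℝ φ z (0, 1)) +
          ∑ i, flux (p i) (g i z) * fderiv ℝ φ z (Pi.single i 1, 0)) := by
  obtain ⟨r, hr0, hr, hφr⟩ := exists_closedBall_of_tsupport_subset hφs hφt
  have hout : ∀ z, z ∉ Metric.ball (0 : (Fin N → ℝ) × ℝ) r → φ z = 0 ∧ fderiv ℝ φ z = 0 :=
    fun z hz => ⟨image_eq_zero_of_notMem_tsupport fun hmem => hz (hφr hmem), by
      by_contra h0
      exact hz (hφr (support_fderiv_subset ℝ (Function.mem_support.2 h0)))⟩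
  refine ⟨Metric.closedBall 0 r, isCompact_closedBall _ _, ?_, -r, ⟨by linarith, by linarith⟩,
    r, ⟨by linarith, hr⟩, by linarith, ⟨hφ.contDiffOn, fun x hx t _ => (hout _ ?_).1,
    fun x t _ => hφ0 _⟩, fun u g => ?_⟩
  · rw [cube_one_eq_ball]
    exact Metric.closedBall_subset_ball hr
  · intro hmem
    refine hx (Metric.ball_subset_closedBall ?_)
    have h2 : ‖(x, t)‖ < r := by simpa using hmem
    simpa using (norm_fst_le (x, t)).trans_lt h2
  · have hend : ∀ s : ℝ, |s| = r → ∀ x : Fin N → ℝ, φ (x, s) = 0 := by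
      intro s hs x
      refine (hout _ fun hmem => ?_).1
      have h2 : ‖(x, s)‖ < r := by simpa using hmem
      have h3 := (norm_snd_le (x, s)).trans_lt h2
      rw [Real.norm_eq_abs, hs] at h3
      exact lt_irrefl _ h3
    have e1 := hend r (abs_of_pos hr0)
    have e2 := hend (-r) (by rw [abs_neg, abs_of_pos hr0])
    simp only [weakForm, e1, e2, mul_zero, integral_zero, sub_zero, zero_add]
    refine setIntegral_eq_integral_of_forall_compl_eq_zero fun z hz => ?_
    have h0 : z ∉ Metric.ball (0 : (Fin N → ℝ) × ℝ) r := fun hmem => hz <| by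
      have := closedBall_subset_cylinder r (Metric.ball_subset_closedBall hmem)
      rwa [max_eq_left hr0.le] at this
    simp [(hout z h0).2]

theorem IsLocalWeakSuperSolution.exists_distributional (hp : ∀ i, 2 ≤ p i)
    (h : IsLocalWeakSuperSolution p (cube N 1) 1 u) :
    ∃ g, IsDistributionalSuperSolution p u g := by
  obtain ⟨-, g, hg, hw⟩ := h
  refine ⟨g, fun r hr => hg.integrableOn_closedBall hr,
    fun i r hr => hg.integrableOn_deriv_closedBall hp i hr,
    fun i r hr => hg.integrableOn_rpow_closedBall hp i hr,
    fun i φ h1 h2 h3 => hg.integral_space_deriv hp i h1 h2 h3, fun φ h1 h2 h3 h4 => ?_⟩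
  obtain ⟨K, hK, hKs, t₁, ht₁, t₂, ht₂, hlt, htest, heq⟩ := exists_weakForm_eq (p := p) h1 h2 h3 h4
  rw [← heq]
  exact hw K hK hKs t₁ ht₁ t₂ ht₂ hlt φ htest

theorem flux_neg (p s : ℝ) : flux p (-s) = -flux p s := by simp [flux]

/-- If `u` is a sub-solution then `1 - u` is a super-solution. -/
theorem IsLocalWeakSubSolution.exists_distributional_one_sub (hp : ∀ i, 2 ≤ p i)
    (h : IsLocalWeakSubSolution p (cube N 1) 1 u) :
    ∃ g, IsDistributionalSuperSolution p (fun z => 1 - u z) g := by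
  obtain ⟨-, g, hg, hw⟩ := h
  refine ⟨fun i z => -g i z, fun r hr => ?_, fun i r hr => ?_, fun i r hr => ?_,
    fun i φ h1 h2 h3 => ?_, fun φ h1 h2 h3 h4 => ?_⟩
  · exact (integrableOn_const measure_closedBall_lt_top.ne).sub (hg.integrableOn_closedBall hr)
  · exact (hg.integrableOn_deriv_closedBall hp i hr).neg
  · simpa only [abs_neg] using hg.integrableOn_rpow_closedBall hp i hr
  · obtain ⟨r, -, hr, hφr⟩ := exists_closedBall_of_tsupport_subset h2 h3
    have hφ1 : ContDiff ℝ 1 φ := h1.of_le (by norm_cast)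
    have hc : Continuous fun z => fderiv ℝ φ z (Pi.single i 1, 0) :=
      (hφ1.continuous_fderiv one_ne_zero).clm_apply continuous_const
    have i1 : Integrable fun z => u z * fderiv ℝ φ z (Pi.single i 1, 0) :=
      integrable_mul_of_tsupport_subset (hg.integrableOn_closedBall hr) hc
        ((tsupport_fderiv_apply_subset_tsupport φ _).trans (hφr.trans Metric.ball_subset_closedBall))
    have i2 := hc.integrable_of_hasCompactSupport (μ := volume) (h2.fderiv_apply ℝ _)
    simp only [sub_mul, one_mul, neg_mul]
    rw [integral_sub i2 i1, integral_fderiv_eq_zero hφ1 h2, hg.integral_space_deriv hp i h1 h2 h3,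
      integral_neg]
    ring
  · obtain ⟨r, -, hr, hφr⟩ := exists_closedBall_of_tsupport_subset h2 h3
    have hφr' := hφr.trans Metric.ball_subset_closedBall
    have hφ1 : ContDiff ℝ 1 φ := h1.of_le (by norm_cast)
    have hc : ∀ e, Continuous fun z => fderiv ℝ φ z e := fun e =>
      (hφ1.continuous_fderiv one_ne_zero).clm_apply continuous_const
    have i1 : Integrable fun z => -(u z * fderiv ℝ φ z (0, 1)) :=
      (integrable_mul_of_tsupport_subset (hg.integrableOn_closedBall hr) (hc _)
        ((tsupport_fderiv_apply_subset_tsupport φ _).trans hφr')).neg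
    have i2 := (hc (0, 1)).integrable_of_hasCompactSupport (μ := volume) (h2.fderiv_apply ℝ _)
    have : IsFiniteMeasure (volume.restrict (Metric.closedBall (0 : (Fin N → ℝ) × ℝ) r)) :=
      ⟨by simpa using measure_closedBall_lt_top⟩
    have i3 : ∀ i, Integrable fun z => flux (p i) (g i z) * fderiv ℝ φ z (Pi.single i 1, 0) :=
      fun i => integrable_mul_of_tsupport_subset
        (integrable_flux (hp i) (hg.integrableOn_deriv_closedBall hp i hr).aestronglyMeasurable
          (hg.integrableOn_rpow_closedBall hp i hr)) (hc _)
        ((tsupport_fderiv_apply_subset_tsupport φ _).trans hφr')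
    obtain ⟨K, hK, hKs, t₁, ht₁, t₂, ht₂, hlt, htest, heq⟩ :=
      exists_weakForm_eq (p := p) h1 h2 h3 h4
    have key := hw K hK hKs t₁ ht₁ t₂ ht₂ hlt φ htest
    rw [heq] at key
    -- The flux is odd, so passing to `1 - u` flips the sign of the weak form. The added constant
    -- contributes only `∂ₜφ`, whose integral is zero.
    have hpt : ∀ z, -((1 - u z) * fderiv ℝ φ z (0, 1)) +
        ∑ i, flux (p i) (-g i z) * fderiv ℝ φ z (Pi.single i 1, 0) =
        -fderiv ℝ φ z (0, 1) - (-(u z * fderiv ℝ φ z (0, 1)) +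
          ∑ i, flux (p i) (g i z) * fderiv ℝ φ z (Pi.single i 1, 0)) := fun z => by
      simp only [flux_neg, neg_mul, Finset.sum_neg_distrib]
      ring
    simp only [hpt]
    have i4 : Integrable fun z => -fderiv ℝ φ z (0, 1) := i2.neg
    have i5 : Integrable fun z => -(u z * fderiv ℝ φ z (0, 1)) +
        ∑ i, flux (p i) (g i z) * fderiv ℝ φ z (Pi.single i 1, 0) :=
      i1.add (integrable_finsetSum _ fun i _ => i3 i)
    rw [integral_sub i4 i5, integral_neg,
      integral_fderiv_eq_zero hφ1 h2]
    linarith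

end FromWeakSolutions

/-! ### The critical mass lemma on intrinsic cylinders, and the conclusion. -/

section IntrinsicCylinders

variable {N : ℕ} {p : Fin N → ℝ}

theorem isOpen_box (c : Fin N → ℝ) : IsOpen {x : Fin N → ℝ | ∀ i, |x i| < c i} := by
  simp only [ofPred_forall]
  exact isOpen_iInter_of_finite fun i => isOpen_lt (by fun_prop) continuous_const

theorem harmonicMean_pos (hN : 0 < N) (hp : ∀ i, 0 < p i) : 0 < harmonicMean p := by
  have : Nonempty (Fin N) := ⟨⟨0, hN⟩⟩
  have h1 : 0 < ∑ i, 1 / p i :=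
    Finset.sum_pos (fun i _ => one_div_pos.2 (hp i)) Finset.univ_nonempty
  have h2 : (0 : ℝ) < N := by exact_mod_cast hN
  unfold harmonicMean
  positivity

theorem measurableSet_backwardIntrinsicCylinder (ρ M : ℝ) :
    MeasurableSet (backwardIntrinsicCylinder p ρ M) :=
  (isOpen_box _).measurableSet.prod measurableSet_Ioc

theorem exists_critical_mass_intrinsic (hN : 1 < N) (hp : ∀ i, 2 ≤ p i) {m M : ℝ} (hmM : m < M)
    (hM : 0 < M) (hM1 : M ≤ 1) :
    ∃ ν : ℝ, 0 < ν ∧ ∀ v g, IsDistributionalSuperSolution p v g →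
      (∀ᵐ z ∂volume.restrict (backwardCylinder N 1 1), 0 ≤ v z) →
      volume ({z | v z ≤ M} ∩ backwardIntrinsicCylinder p 1 M) ≤
        ENNReal.ofReal ν * volume (backwardIntrinsicCylinder p 1 M) →
      ∀ᵐ z ∂volume.restrict (backwardIntrinsicCylinder p (1 / 2) M), m ≤ v z := by
  have hp0 : ∀ i, 0 < p i := fun i => by linarith [hp i]
  have hh : 0 < harmonicMean p := harmonicMean_pos (by omega) hp0
  set R : Fin N → ℝ := fun i => M ^ ((p i - 2) / p i) with hR
  have hR0 : ∀ i, 0 < R i := fun i => Real.rpow_pos_of_pos hM _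
  have hR1 : ∀ i, R i ≤ 1 := fun i =>
    Real.rpow_le_one hM.le hM1 (div_nonneg (by linarith [hp i]) (hp0 i).le)
  set R' : Fin N → ℝ := fun i => R i * (1 / 2) ^ (harmonicMean p / p i) with hR'
  have hR'R : ∀ i, R' i < R i := fun i => mul_lt_of_lt_one_right (hR0 i)
    (Real.rpow_lt_one (by norm_num) (by norm_num) (div_pos hh (hp0 i)))
  have hτ : ((1 : ℝ) / 2) ^ harmonicMean p < 1 :=
    Real.rpow_lt_one (by norm_num) (by norm_num) hh
  set C : Set ((Fin N → ℝ) × ℝ) := (univ.pi fun i => Icc (-R' i) (R' i)) ×ˢ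
    Icc (-((1 : ℝ) / 2) ^ harmonicMean p) 0 with hC
  -- An open set reaching beyond `t = 0`, so that the barrier can equal `M` up to the final time;
  -- only its part with `t ≤ 0` enters the mass. The bound `M ≤ 1` keeps it in the unit ball.
  set O : Set ((Fin N → ℝ) × ℝ) := {x : Fin N → ℝ | ∀ i, |x i| < R i} ×ˢ Ioo (-1 : ℝ) 1 with hO
  have hQO : O ∩ {z | z.2 ≤ 0} ⊆ backwardIntrinsicCylinder p 1 M := by
    rintro z ⟨⟨hz1, hz2⟩, hz3⟩
    refine ⟨fun i => ?_, ?_⟩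
    · simpa using hz1 i
    · rw [Real.one_rpow]
      exact ⟨hz2.1, hz3⟩
  have hbound : O ⊆ Metric.ball 0 1 := by
    rintro z ⟨hz1, hz2⟩
    have h1 : ‖z.1‖ < 1 := (pi_norm_lt_iff one_pos).2 fun i => (hz1 i).trans_le (hR1 i)
    have h2 : ‖z.2‖ < 1 := abs_lt.2 hz2
    simpa [Prod.norm_def] using And.intro h1 h2
  obtain ⟨ν, hν, hmain⟩ := exists_critical_mass (p := p) (C := C) (O := O) hN hp
    ((isCompact_univ_pi fun i => isCompact_Icc).prod isCompact_Icc)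
    ((isOpen_box R).prod isOpen_Ioo)
    (fun z hz => ⟨fun i => (abs_le.2 (hz.1 i (mem_univ i))).trans_lt (hR'R i),
      by linarith [hz.2.1], by linarith [hz.2.2]⟩) hbound hmM hM
  set V := volume (backwardIntrinsicCylinder p 1 M) with hV
  have hVfin : V ≠ ⊤ := by
    refine ne_top_of_le_ne_top
      (measure_closedBall_lt_top (x := (0 : (Fin N → ℝ) × ℝ)) (r := 1)).ne
      (measure_mono fun z hz => ?_)
    have h1 : ‖z.1‖ ≤ 1 := (pi_norm_le_iff_of_nonneg zero_le_one).2 fun i => by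
      have := hz.1 i
      rw [Real.one_rpow, mul_one] at this
      exact this.le.trans (hR1 i)
    have h2 : ‖z.2‖ ≤ 1 := abs_le.2 ⟨by have := hz.2.1; rw [Real.one_rpow] at this; exact this.le,
      hz.2.2.trans zero_le_one⟩
    simpa [Prod.norm_def] using And.intro h1 h2
  -- Converts an absolute threshold into one relative to the volume `V`; the `+ 1` avoids having to
  -- know that `V` is positive.
  refine ⟨ν / (V.toReal + 1), by positivity, fun v g h hpos h0 => ?_⟩
  have hpos' : ∀ᵐ z, z ∈ Metric.ball (0 : (Fin N → ℝ) × ℝ) 1 → z.2 ≤ 0 → 0 ≤ v z := by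
    have hm : MeasurableSet (backwardCylinder N 1 1) :=
      (isOpen_box fun _ => (1 : ℝ)).measurableSet.prod measurableSet_Ioc
    filter_upwards [(ae_restrict_iff' hm).1 hpos] with z hz hzb hzt
    have h1 : ‖z‖ < 1 := by simpa using hzb
    have h2 : |z.2| < 1 := (norm_snd_le z).trans_lt h1
    exact hz ⟨fun i => (norm_le_pi_norm z.1 i).trans_lt ((norm_fst_le z).trans_lt h1),
      (abs_lt.1 h2).1, hzt⟩
  have hmass : volume ({z | v z ≤ M} ∩ (O ∩ {z | z.2 ≤ 0})) ≤ ENNReal.ofReal ν := by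
    refine (measure_mono (inter_subset_inter_right _ hQO)).trans (h0.trans ?_)
    rw [← ENNReal.ofReal_toReal hVfin, ← ENNReal.ofReal_mul (by positivity),
      ENNReal.toReal_ofReal ENNReal.toReal_nonneg]
    refine ENNReal.ofReal_le_ofReal ?_
    have hV0 : 0 ≤ V.toReal := ENNReal.toReal_nonneg
    rw [div_mul_eq_mul_div, div_le_iff₀ (by positivity)]
    nlinarith
  refine (ae_restrict_iff' (measurableSet_backwardIntrinsicCylinder _ _)).2 ?_
  filter_upwards [hmain v g h hpos' hmass] with z hz hzQ
  exact hz ⟨fun i _ => abs_le.1 (hzQ.1 i).le, hzQ.2.1.le, hzQ.2.2⟩ hzQ.2.2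

end IntrinsicCylinders

end AnisotropicParabolic

theorem lemma3p3 (N : ℕ) (hN : 1 < N) (p : Fin N → ℝ)
    (hp_two : ∀ i, 2 < p i)
    (hp_mean : harmonicMean p < (N : ℝ))
    (hp_sobolev : ∀ i, p i < sobolevExponent p)
    (a : ℝ) (ha : a ∈ Ioo (0 : ℝ) 1) :
    (∃ ν : ℝ, 0 < ν ∧ ∀ u : (Fin N → ℝ) × ℝ → ℝ,
      IsLocalWeakSuperSolution p (cube N 1) 1 u →
      (0 : EReal) ≤ essInfOn (backwardCylinder N 1 1) u →
      volume ({z | u z ≤ 1} ∩ backwardIntrinsicCylinder p 1 1)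
        ≤ ENNReal.ofReal ν * volume (backwardIntrinsicCylinder p 1 1) →
      (a : EReal) ≤ essInfOn (backwardIntrinsicCylinder p (1 / 2) 1) u) ∧
    (∃ ν : ℝ, 0 < ν ∧ ∀ u : (Fin N → ℝ) × ℝ → ℝ,
      IsLocalWeakSubSolution p (cube N 1) 1 u →
      essSupOn (backwardCylinder N 1 1) u ≤ (1 : EReal) →
      volume ({z | 1 / 2 ≤ u z} ∩ backwardIntrinsicCylinder p 1 (1 / 2))
        ≤ ENNReal.ofReal ν * volume (backwardIntrinsicCylinder p 1 (1 / 2)) →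
      essSupOn (backwardIntrinsicCylinder p (1 / 2) (1 / 2)) u
        ≤ ((1 - a / 2 : ℝ) : EReal)) := by
  have hp : ∀ i, 2 ≤ p i := fun i => (hp_two i).le
  constructor
  · obtain ⟨ν, hν, hmain⟩ := exists_critical_mass_intrinsic hN hp ha.2 one_pos le_rfl
    refine ⟨ν, hν, fun u hu hinf hmass => ?_⟩
    obtain ⟨g, hg⟩ := hu.exists_distributional hp
    have hpos : ∀ᵐ z ∂volume.restrict (backwardCylinder N 1 1), 0 ≤ u z := by
      have h1 : ∀ᵐ z ∂volume.restrict (backwardCylinder N 1 1),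
          essInfOn (backwardCylinder N 1 1) u ≤ (u z : EReal) := ae_essInf_le
      filter_upwards [h1] with z hz
      exact_mod_cast hinf.trans hz
    refine le_essInf_of_ae_le _ ?_
    filter_upwards [hmain u g hg hpos hmass] with z hz
    exact_mod_cast hz
  -- For `v = 1 - u`, the set `{u ≥ 1/2}` is `{v ≤ 1/2}`, and `u ≤ 1 - a/2` means `v ≥ a/2`.
  · obtain ⟨ν, hν, hmain⟩ := exists_critical_mass_intrinsic (m := a / 2) (M := 1 / 2) hN hp
      (by linarith [ha.2]) (by norm_num) (by norm_num)
    refine ⟨ν, hν, fun u hu hsup hmass => ?_⟩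
    obtain ⟨g, hg⟩ := hu.exists_distributional_one_sub hp
    have hpos : ∀ᵐ z ∂volume.restrict (backwardCylinder N 1 1), 0 ≤ 1 - u z := by
      have h1 : ∀ᵐ z ∂volume.restrict (backwardCylinder N 1 1),
          (u z : EReal) ≤ essSupOn (backwardCylinder N 1 1) u := ae_le_essSup
      filter_upwards [h1] with z hz
      have : u z ≤ 1 := by exact_mod_cast hz.trans hsup
      linarith
    have hset : {z | 1 - u z ≤ 1 / 2} = {z | 1 / 2 ≤ u z} := by
      ext z
      constructor <;> intro hz <;> simp only [mem_ofPred_eq] at hz ⊢ <;> linarith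
    refine essSup_le_of_ae_le _ ?_
    filter_upwards [hmain _ g hg hpos (by rwa [hset])] with z hz
    exact_mod_cast (by linarith : u z ≤ 1 - a / 2)
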